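/- Let $r\ge 2$ and let $n_1,\dots,n_r\ge 1$ be odd integers. Let $G$ be the multigraph obtained from $r$ cycles of lengths $n_1,\dots,n_r$ (a cycle of length $1$ is a loop) by gluing them at one common vertex: the $j$-th cycle has vertices $v_{j0},v_{j1},\dots,v_{jn_j}=v_{j0}$ and edges $e_{jl}$ joining $v_{j\,l-1}$ and $v_{jl}$ $(1\le l\le n_j)$, and the vertices $v_{10},\dots,v_{r0}$ are identified. Orient each edge arbitrarily, parametrize it by $[0,1]$ in this direction, and let $q_{jl}\in L^1(0,1)$ (real or complex valued) be a potential on $e_{jl}$. For $\lambda\in\mathbb C$ and each edge $e$ with potential $q_e$, let $c_e(\cdot,\lambda)$, $s_e(\cdot,\lambda)$ be the solutions of $-y''+q_e y=\lambda y$ on $[0,1]$ with $c_e(0)=1,\ c_e'(0)=0$ and $s_e(0)=0,\ s_e'(0)=1$; write $s_{jl}=s_{e_{jl}}$. Let $M=M(\lambda)=\begin{pmatrix}A&B\\ C&D\end{pmatrix}$, with rows and columns indexed by the vertices followed by the edges, where - $A_{vu}=\frac1{\sqrt\lambda}\sum c_e'(1,\lambda)$, the sum being over the edges $e$ pointing from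 $u$ to $v$; - $B_{ve}=s_e'(1,\lambda)$ if $e$ ends in $v$, $-1$ if $e$ starts from $v$, $s_e'(1,\lambda)-1$ if $e$ is a loop at $v$, and $0$ otherwise; - $C_{ev}=-1$ if $e$ ends in $v$, $c_e(1,\lambda)$ if $e$ starts from $v$, $-1+c_e(1,\lambda)$ if $e$ is a loop at $v$, and $0$ otherwise; - $D$ is diagonal with $D_{ee}=\sqrt\lambda\, s_e(1,\lambda)$, and $\sqrt\lambda$ is the principal square root. All asymptotic relations are for $\lambda$ and $k$ varying together with $k\in\mathbb N$, $k\to\infty$ (along an arbitrary sequence or, more generally, an arbitrary filter). (i) If $\lambda=(2k+1)^2\pi^2+O(1)$, then $$\det M=-4\sum_{i=1}^{r}\prod_{j\ne i}\sum_{l=1}^{n_j}\sqrt{\lambda}\,s_{jl}(1,\lambda)+o\bigl(|\lambda|^{-r/2}\bigr).$$ (ii) If $d\in\mathbb C$ is fixed and $\lambda=(2k+1)^2\pi^2+d+o(1)$, then $$\det M=-4\left(\frac{-1}{2\sqrt{\lambda}}\right)^{r-1}p(d)+o\bigl(|\lambda|^{-(r-1)/2}\bigr),\qquad p(d)=\sum_{i=1}^{r}\prod_{j\ne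 i}\Bigl(n_jd-\sum_{l=1}^{n_j}\int_0^1q_{jl}(x)\,dx\Bigr).$$ -/

import Mathlib

open Filter Asymptotics MeasureTheory

namespace QuantumGraph

/-- `y` solves `-y'' + q y = lam y` on `[0,1]` for an integrable potential `q` (Carathéodory sense):
`y` is differentiable on `[0,1]` (one-sidedly at the end points) and `y'` is the indefinite integral
of `(q - lam) y`. Equivalently, `y'` is absolutely continuous and the equation holds
almost everywhere. -/
structure IsSolution (q : ℝ → ℂ) (lam : ℂ) (y : ℝ → ℂ) : Prop where
  differentiableOn : DifferentiableOn ℝ y (Set.Icc 0 1)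
  deriv_eq : ∀ x ∈ Set.Icc (0 : ℝ) 1,
    derivWithin y (Set.Icc 0 1) x
      = derivWithin y (Set.Icc 0 1) 0 + ∫ t in (0 : ℝ)..x, (q t - lam) * y t

open Classical in
/-- The solution on `[0,1]` of `-y'' + q y = lam y` with `y(0) = a`, `y'(0) = b`. For integrable `q`
it exists, and it is unique on `[0,1]`, so that the default value `0` is not used. -/
noncomputable def ivpSolution (q : ℝ → ℂ) (lam a b : ℂ) : ℝ → ℂ :=
  if h : ∃ y : ℝ → ℂ, IsSolution q lam y ∧ y 0 = a ∧ derivWithin y (Set.Icc 0 1) 0 = b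
  then h.choose else 0

/-- `c(x, lam)`: the solution with `c(0) = 1`, `c'(0) = 0`. -/
noncomputable def cosSol (q : ℝ → ℂ) (lam : ℂ) : ℝ → ℂ := ivpSolution q lam 1 0

/-- `s(x, lam)`: the solution with `s(0) = 0`, `s'(0) = 1`. -/
noncomputable def sinSol (q : ℝ → ℂ) (lam : ℂ) : ℝ → ℂ := ivpSolution q lam 0 1

/-- `c'(1, lam)`. -/
noncomputable def cosSolDerivOne (q : ℝ → ℂ) (lam : ℂ) : ℂ :=
  derivWithin (cosSol q lam) (Set.Icc 0 1) 1

/-- `s'(1, lam)`. -/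
noncomputable def sinSolDerivOne (q : ℝ → ℂ) (lam : ℂ) : ℂ :=
  derivWithin (sinSol q lam) (Set.Icc 0 1) 1

/-- The square root of the spectral parameter (principal branch). -/
noncomputable def sqrtParam (lam : ℂ) : ℂ := lam ^ (1 / 2 : ℂ)

/-- An oriented multigraph (loops and multiple edges allowed); the edge `e` points from `src e`
to `tgt e` and is parametrized by `[0,1]` in this direction. -/
structure OrientedGraph (V E : Type*) where
  src : E → V
  tgt : E → V

section Matrix

variable {V E : Type*} [Fintype E] [DecidableEq V] [DecidableEq E]

/-- Block `A`: the `(v, u)` entry is `lam^{-1/2} ∑ c_e'(1, lam)` over the edges from `u` to `v`. -/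
noncomputable def blockA (G : OrientedGraph V E) (q : E → ℝ → ℂ) (lam : ℂ) : Matrix V V ℂ :=
  Matrix.of fun v u =>
    1 / sqrtParam lam *
      ∑ e ∈ Finset.univ.filter (fun e => G.src e = u ∧ G.tgt e = v), cosSolDerivOne (q e) lam

/-- Block `B`: the `(v, e)` entry is `s_e'(1, lam)` if `e` ends in `v`, `-1` if `e` starts from `v`,
`s_e'(1, lam) - 1` if `e` is a loop at `v`, and `0` otherwise. -/
noncomputable def blockB (G : OrientedGraph V E) (q : E → ℝ → ℂ) (lam : ℂ) : Matrix V E ℂ :=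
  Matrix.of fun v e =>
    (if G.tgt e = v then sinSolDerivOne (q e) lam else 0) - (if G.src e = v then 1 else 0)

/-- Block `C`: the `(e, v)` entry is `-1` if `e` ends in `v`, `c_e(1, lam)` if `e` starts from `v`,
`-1 + c_e(1, lam)` if `e` is a loop at `v`, and `0` otherwise. -/
noncomputable def blockC (G : OrientedGraph V E) (q : E → ℝ → ℂ) (lam : ℂ) : Matrix E V ℂ :=
  Matrix.of fun e v =>
    (if G.src e = v then cosSol (q e) lam 1 else 0) - (if G.tgt e = v then 1 else 0)

/-- Block `D`: the diagonal matrix with entries `lam^{1/2} s_e(1, lam)`. -/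
noncomputable def blockD (q : E → ℝ → ℂ) (lam : ℂ) : Matrix E E ℂ :=
  Matrix.diagonal fun e => sqrtParam lam * sinSol (q e) lam 1

/-- The matrix `M(lam)` of the linear system formed by the Kirchhoff conditions at the vertices and
the continuity conditions at the terminal ends of the edges. -/
noncomputable def secularMatrix (G : OrientedGraph V E) (q : E → ℝ → ℂ) (lam : ℂ) :
    Matrix (V ⊕ E) (V ⊕ E) ℂ :=
  Matrix.fromBlocks (blockA G q lam) (blockB G q lam) (blockC G q lam) (blockD q lam)

end Matrix

/-- Vertices of the graph formed by cycles of lengths `n j` glued at a common vertex: `none` is the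
common vertex, and the cycle `j` has `n j - 1` further ones. -/
abbrev GluedVertex {r : ℕ} (n : Fin r → ℕ) : Type := Option ((j : Fin r) × Fin (n j - 1))

/-- Edges of this graph: the cycle `j` has `n j` edges. -/
abbrev GluedEdge {r : ℕ} (n : Fin r → ℕ) : Type := (j : Fin r) × Fin (n j)

/-- The vertex `v_{j,k}`, for `0 ≤ k ≤ n j`; both `v_{j,0}` and `v_{j,n j}` are the common
vertex, and the other ones are distinct. -/
def gluedVertex {r : ℕ} (n : Fin r → ℕ) (j : Fin r) (k : ℕ) : GluedVertex n :=
  if h : 1 ≤ k ∧ k < n j then some ⟨j, ⟨k - 1, by omega⟩⟩ else none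

/-- The cycles of lengths `n j` glued at a common vertex. The edge `⟨j, l⟩` (with `l` from `0` to
`n j - 1`) joins `v_{j,l}` and `v_{j,l+1}`; it is oriented from `v_{j,l}` to `v_{j,l+1}` if
`fwd ⟨j, l⟩` is true and the other way if it is false. -/
def gluedCycles {r : ℕ} (n : Fin r → ℕ) (fwd : GluedEdge n → Bool) :
    OrientedGraph (GluedVertex n) (GluedEdge n) where
  src e := if fwd e then gluedVertex n e.1 e.2 else gluedVertex n e.1 (e.2 + 1)
  tgt e := if fwd e then gluedVertex n e.1 (e.2 + 1) else gluedVertex n e.1 e.2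

/-- `p(d) = ∑_i ∏_{j ≠ i} (n_j d - ∑_l ∫_0^1 q_{jl})`. -/
noncomputable def eigPol {r : ℕ} (n : Fin r → ℕ) (q : GluedEdge n → ℝ → ℂ) (d : ℂ) : ℂ :=
  ∑ i : Fin r, ∏ j ∈ Finset.univ.erase i,
    ((n j : ℂ) * d - ∑ l : Fin (n j), ∫ t in (0 : ℝ)..1, q ⟨j, l⟩ t)

end QuantumGraph

namespace QuantumGraph

/-! The proof has an analytic half and an algebraic half, joined by a weighted perturbation estimate
for determinants.

Analysis. Put ω = (2k+1)π, so that e^{iω} = -1 and μ = λ - ω² stays bounded. For a solution y the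
combinations y' ± iωy satisfy first order equations with source (q - μ)y. Variation of constants
gives an a priori bound on y and shows that y is close to the free solution. Inserting the latter
leaves the mean of q - μ and an oscillatory integral, which vanishes in the limit by
Riemann–Lebesgue (`isLittleO_endpoint`). Hence c(1) and s'(1) are -1 + o(1/ω), c'(1) = O(1), and
ω²s(1) = (∫q - μ)/2 + o(1).

Algebra. In the limit, A is dropped and B, C become -I, -Iᵀ, where I is the unsigned incidence
matrix; the orientation disappears. I is not singular along an odd cycle: the alternating vector of
the cycle is sent to 2 at the common vertex and to 0 elsewhere. Eliminating the interior vertices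
along these vectors reduces the determinant to that of a diagonal matrix, whose entries are the
cycle sums of D, bordered by the constant -2. This produces the factor -4 and the sum of products
(`det_unsignedIncidence_saddle`).

Comparison. Give the edge rows weight |λ|^{-1/2}, the vertex columns weight |λ|^{1/2} and the rest
weight 1. Relative to these weights every entry is perturbed by o(|λ|^{-1/2}), so by
`isLittleO_det_sub_det` the determinant changes by o(|λ|^{(|V|-|E|-1)/2}). Since |E| - |V| + 1 = r,
this is (i). Inserting the asymptotics of s into (i) gives (ii). -/

/-! ### Existence for the initial value problem -/

/-- The twice integrated right-hand side of the initial value problem is continuous. -/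
theorem continuous_integral_integral_mul {Q f : ℝ → ℂ} (hQ : Integrable Q) (hf : Continuous f) :
    Continuous fun x => ∫ s in (0 : ℝ)..x, ∫ t in (0 : ℝ)..s, Q t * f t := by
  have h : ∀ a b : ℝ, IntervalIntegrable (fun t => Q t * f t) volume a b := fun a b =>
    hQ.intervalIntegrable.mul_continuousOn hf.continuousOn
  exact intervalIntegral.continuous_primitive
    (fun a b => (intervalIntegral.continuous_primitive h 0).intervalIntegrable a b) 0

/-- A Volterra equation of the second order with an integrable coefficient has a solution. -/
theorem exists_volterra_solution {Q : ℝ → ℂ} (hQ : Integrable Q) (a b : ℂ) :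
    ∃ y : ℝ → ℂ, Continuous y ∧ ∀ x ∈ Set.Icc (0 : ℝ) 1,
      y x = a + b * x + ∫ s in (0 : ℝ)..x, ∫ t in (0 : ℝ)..s, Q t * y t := by
  classical
  set N : ℝ := ∫ t, ‖Q t‖ with hN
  have hN0 : 0 ≤ N := integral_nonneg fun _ => norm_nonneg _
  -- In the norm weighted by e^{-Kt} the Volterra operator has Lipschitz constant at most N/K; the
  -- choice of K makes this less than 1/2, with no smallness of Q.
  set K : ℝ := 2 * N + 1 with hK
  have hK0 : 0 < K := by positivity
  have h01 : (0 : ℝ) ≤ 1 := zero_le_one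
  -- The fixed point problem is posed for z = e^{-Kt} y with the plain sup norm; `ext z` recovers y,
  -- extended continuously to the line.
  let ext : C(Set.Icc (0 : ℝ) 1, ℂ) → ℝ → ℂ := fun z t =>
    (Real.exp (K * t) : ℂ) * Set.IccExtend h01 z t
  have hext : ∀ z, Continuous (ext z) := fun z => by
    have : Continuous (Set.IccExtend h01 z) := z.continuous.Icc_extend'
    fun_prop
  have hint : ∀ z (a b : ℝ), IntervalIntegrable (fun t => Q t * ext z t) volume a b :=
    fun z a b => hQ.intervalIntegrable.mul_continuousOn (hext z).continuousOn
  have hcont : ∀ z, Continuous fun s => ∫ t in (0 : ℝ)..s, Q t * ext z t := fun z =>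
    intervalIntegral.continuous_primitive (hint z) 0
  let S : C(Set.Icc (0 : ℝ) 1, ℂ) → C(Set.Icc (0 : ℝ) 1, ℂ) := fun z =>
    ⟨fun x => (Real.exp (-(K * x)) : ℂ) *
      (a + b * (x : ℝ) + ∫ s in (0 : ℝ)..x, ∫ t in (0 : ℝ)..s, Q t * ext z t), by
      have := (continuous_integral_integral_mul hQ (hext z)).comp
        (continuous_subtype_val (p := fun x : ℝ => x ∈ Set.Icc (0 : ℝ) 1))
      simp only [Function.comp_def] at this
      fun_prop⟩
  have hS : ContractingWith (1 / 2) S := by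
    refine ⟨by rw [← NNReal.coe_lt_coe]; norm_num, LipschitzWith.of_dist_le_mul fun z z' => ?_⟩
    rw [ContinuousMap.dist_le (by positivity)]
    rintro ⟨x, hx⟩
    set δ := dist z z' with hδ
    have hδ0 : 0 ≤ δ := dist_nonneg
    have hdiff : ∀ t, ‖ext z t - ext z' t‖ ≤ Real.exp (K * t) * δ := fun t => by
      simp only [ext, ← mul_sub, norm_mul, Complex.norm_real, Real.norm_eq_abs, Real.abs_exp]
      gcongr
      rw [← dist_eq_norm]
      exact ContinuousMap.dist_apply_le_dist _
    have hinner : ∀ s, 0 ≤ s → ‖(∫ t in (0 : ℝ)..s, Q t * ext z t) -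
        ∫ t in (0 : ℝ)..s, Q t * ext z' t‖ ≤ N * δ * Real.exp (K * s) := fun s hs => by
      rw [← intervalIntegral.integral_sub (hint _ _ _) (hint _ _ _)]
      calc _ ≤ ∫ t in (0 : ℝ)..s, ‖Q t‖ * (Real.exp (K * s) * δ) := by
            refine intervalIntegral.norm_integral_le_of_norm_le hs
              (ae_of_all _ fun t ht => ?_) (hQ.norm.intervalIntegrable.mul_const _)
            rw [← mul_sub, norm_mul]
            have := hdiff t
            have h2 : Real.exp (K * t) ≤ Real.exp (K * s) :=
              Real.exp_le_exp.2 (by nlinarith [ht.2])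
            gcongr
            exact this.trans (by gcongr)
        _ = (∫ t in (0 : ℝ)..s, ‖Q t‖) * (Real.exp (K * s) * δ) := by
            rw [intervalIntegral.integral_mul_const]
        _ ≤ N * (Real.exp (K * s) * δ) := by
            gcongr
            rw [intervalIntegral.integral_of_le hs]
            exact setIntegral_le_integral hQ.norm (ae_of_all _ fun _ => norm_nonneg _)
        _ = _ := by ring
    have hexp : ∫ s in (0 : ℝ)..x, Real.exp (K * s) = (Real.exp (K * x) - 1) / K := by
      rw [intervalIntegral.integral_comp_mul_left _ hK0.ne']
      simp [div_eq_inv_mul]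
    rw [dist_eq_norm]
    simp only [S, ContinuousMap.coe_mk]
    rw [← mul_sub, add_sub_add_left_eq_sub, ← intervalIntegral.integral_sub
      ((hcont z).intervalIntegrable _ _) ((hcont z').intervalIntegrable _ _), norm_mul,
      Complex.norm_real, Real.norm_eq_abs, Real.abs_exp]
    calc _ ≤ Real.exp (-(K * x)) * ∫ s in (0 : ℝ)..x, N * δ * Real.exp (K * s) := by
          gcongr
          exact intervalIntegral.norm_integral_le_of_norm_le hx.1
            (ae_of_all _ fun s hs => hinner s hs.1.le)
            (Continuous.intervalIntegrable (by fun_prop) _ _)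
      _ = N * δ / K * (1 - Real.exp (-(K * x))) := by
          rw [intervalIntegral.integral_const_mul, hexp, Real.exp_neg]
          field_simp [Real.exp_ne_zero]
      _ ≤ N * δ / K * 1 := by
          gcongr
          linarith [Real.exp_pos (-(K * x))]
      _ ≤ _ := by
          push_cast
          rw [mul_one, div_le_iff₀ hK0]
          nlinarith
  refine ⟨ext (hS.fixedPoint S), hext _, fun x hx => ?_⟩
  have hfix := congrArg (fun g : C(Set.Icc (0 : ℝ) 1, ℂ) => g ⟨x, hx⟩) hS.fixedPoint_isFixedPt.eq
  simp only [S, ContinuousMap.coe_mk] at hfix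
  have hmul : (Real.exp (K * x) : ℂ) * Real.exp (-(K * x)) = 1 := by
    rw [← Complex.ofReal_mul, ← Real.exp_add, add_neg_cancel, Real.exp_zero, Complex.ofReal_one]
  calc ext (hS.fixedPoint S) x = (Real.exp (K * x) : ℂ) * hS.fixedPoint S ⟨x, hx⟩ := by
        simp only [ext, Set.IccExtend_of_mem h01 _ hx]
    _ = _ := by rw [← hfix, ← mul_assoc, hmul, one_mul]

theorem intervalIntegrable_sub_const_mul {q y : ℝ → ℂ} (hq : IntervalIntegrable q volume 0 1)
    (c : ℂ) (hy : ContinuousOn y (Set.Icc 0 1)) {x : ℝ} (hx : x ∈ Set.Icc (0 : ℝ) 1) :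
    IntervalIntegrable (fun t => (q t - c) * y t) volume 0 x := by
  have hsub : Set.uIcc 0 x ⊆ Set.uIcc (0 : ℝ) 1 := by
    rw [Set.uIcc_of_le hx.1, Set.uIcc_of_le zero_le_one]
    exact Set.Icc_subset_Icc_right hx.2
  refine ((hq.mono_set hsub).sub intervalIntegrable_const).mul_continuousOn (hy.mono ?_)
  rwa [Set.uIcc_of_le zero_le_one] at hsub

/-- The initial value problem with an integrable potential is solvable. -/
theorem exists_isSolution {q : ℝ → ℂ} (hq : IntervalIntegrable q volume 0 1) (lam a b : ℂ) :
    ∃ y : ℝ → ℂ, IsSolution q lam y ∧ y 0 = a ∧ derivWithin y (Set.Icc 0 1) 0 = b := by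
  -- Cutting off makes the coefficient integrable on the whole line; the equation on [0,1] does not
  -- see the change.
  set Q : ℝ → ℂ := Set.indicator (Set.Ioc 0 1) fun t => q t - lam with hQdef
  have hQ : Integrable Q :=
    (integrable_indicator_iff measurableSet_Ioc).2
      ((intervalIntegrable_iff_integrableOn_Ioc_of_le zero_le_one).1
        (hq.sub intervalIntegrable_const))
  obtain ⟨y, hyc, hy⟩ := exists_volterra_solution hQ a b
  have hQy : ∀ x ∈ Set.Icc (0 : ℝ) 1, ∫ t in (0 : ℝ)..x, Q t * y t
      = ∫ t in (0 : ℝ)..x, (q t - lam) * y t := fun x hx => by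
    refine intervalIntegral.integral_congr_ae (ae_of_all _ fun t ht => ?_)
    rw [Set.uIoc_of_le hx.1] at ht
    have ht' : t ∈ Set.Ioc (0 : ℝ) 1 := ⟨ht.1, ht.2.trans hx.2⟩
    simp only [hQdef]
    rw [Set.indicator_of_mem ht']
  have hcont : Continuous fun s => ∫ t in (0 : ℝ)..s, Q t * y t :=
    intervalIntegral.continuous_primitive
      (fun _ _ => hQ.intervalIntegrable.mul_continuousOn hyc.continuousOn) 0
  have hderiv : ∀ x ∈ Set.Icc (0 : ℝ) 1,
      HasDerivWithinAt y (b + ∫ t in (0 : ℝ)..x, Q t * y t) (Set.Icc 0 1) x := fun x hx => by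
    have h1 : HasDerivAt (fun x : ℝ => a + b * (x : ℂ) +
        ∫ s in (0 : ℝ)..x, ∫ t in (0 : ℝ)..s, Q t * y t)
        (b + ∫ t in (0 : ℝ)..x, Q t * y t) x := by
      have h2 : HasDerivAt (fun x : ℝ => a + b * (x : ℂ)) b x := by
        simpa using ((Complex.ofRealCLM.hasDerivAt (x := x)).const_mul b).const_add a
      exact h2.add (intervalIntegral.integral_hasDerivAt_right (hcont.intervalIntegrable _ _)
        (hcont.stronglyMeasurableAtFilter _ _) hcont.continuousAt)
    exact h1.hasDerivWithinAt.congr hy (hy x hx)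
  have hdw : ∀ x ∈ Set.Icc (0 : ℝ) 1,
      derivWithin y (Set.Icc 0 1) x = b + ∫ t in (0 : ℝ)..x, Q t * y t := fun x hx =>
    (hderiv x hx).derivWithin (uniqueDiffOn_Icc zero_lt_one x hx)
  have h0 : (0 : ℝ) ∈ Set.Icc (0 : ℝ) 1 := ⟨le_rfl, zero_le_one⟩
  have hd0 : derivWithin y (Set.Icc 0 1) 0 = b := by simpa using hdw 0 h0
  refine ⟨y, ⟨fun x hx => (hderiv x hx).differentiableWithinAt, fun x hx => ?_⟩, ?_, hd0⟩
  · rw [hdw x hx, hd0, hQy x hx]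
  · simpa using hy 0 h0

theorem ivpSolution_spec {q : ℝ → ℂ} (hq : IntervalIntegrable q volume 0 1) (lam a b : ℂ) :
    IsSolution q lam (ivpSolution q lam a b) ∧ ivpSolution q lam a b 0 = a ∧
      derivWithin (ivpSolution q lam a b) (Set.Icc 0 1) 0 = b := by
  have h := exists_isSolution hq lam a b
  rw [ivpSolution, dif_pos h]
  exact h.choose_spec

/-! ### Variation of constants -/

/-- The derivative of a solution is continuous. -/
theorem IsSolution.continuousOn_derivWithin {q y : ℝ → ℂ} {lam : ℂ}
    (hq : IntervalIntegrable q volume 0 1) (h : IsSolution q lam y) :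
    ContinuousOn (derivWithin y (Set.Icc 0 1)) (Set.Icc 0 1) := by
  have hi : IntegrableOn (fun t => (q t - lam) * y t) (Set.Icc 0 1) := by
    rw [integrableOn_Icc_iff_integrableOn_Ioc,
      ← intervalIntegrable_iff_integrableOn_Ioc_of_le zero_le_one]
    exact intervalIntegrable_sub_const_mul hq lam h.differentiableOn.continuousOn
      ⟨zero_le_one, le_rfl⟩
  have := intervalIntegral.continuousOn_primitive_interval (a := (0 : ℝ)) (b := 1)
    (f := fun t => (q t - lam) * y t) (μ := volume) (by rwa [Set.uIcc_of_le zero_le_one])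
  rw [Set.uIcc_of_le zero_le_one] at this
  exact (continuousOn_const.add this).congr h.deriv_eq

/-- A solution is the indefinite integral of its derivative. -/
theorem IsSolution.eq_add_integral {q y : ℝ → ℂ} {lam : ℂ}
    (hq : IntervalIntegrable q volume 0 1) (h : IsSolution q lam y) {x : ℝ}
    (hx : x ∈ Set.Icc (0 : ℝ) 1) :
    y x = y 0 + ∫ t in (0 : ℝ)..x, derivWithin y (Set.Icc 0 1) t := by
  have hsub : Set.Icc 0 x ⊆ Set.Icc (0 : ℝ) 1 := Set.Icc_subset_Icc_right hx.2
  rw [intervalIntegral.integral_eq_sub_of_hasDeriv_right_of_le hx.1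
    (h.differentiableOn.continuousOn.mono hsub) (f' := derivWithin y (Set.Icc 0 1))]
  · ring
  · intro t ht
    have ht' : t ∈ Set.Icc (0 : ℝ) 1 := hsub (Set.Ioo_subset_Icc_self ht)
    have := (h.differentiableOn t ht').hasDerivWithinAt.hasDerivAt
      (Icc_mem_nhds ht.1 (ht.2.trans_le hx.2))
    exact this.hasDerivWithinAt
  · refine ContinuousOn.intervalIntegrable ?_
    rw [Set.uIcc_of_le hx.1]
    exact (h.continuousOn_derivWithin hq).mono hsub

/-- Integration by parts on a triangle for the primitive of an integrable function. -/
theorem integral_mul_primitive {f g : ℝ → ℂ} {x : ℝ} (hx : 0 ≤ x) (hf : Continuous f)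
    (hg : IntervalIntegrable g volume 0 x) :
    ∫ s in (0 : ℝ)..x, f s * ∫ t in (0 : ℝ)..s, g t
      = ∫ t in (0 : ℝ)..x, (∫ s in t..x, f s) * g t := by
  have hg' : IntegrableOn g (Set.Ioc 0 x) :=
    (intervalIntegrable_iff_integrableOn_Ioc_of_le hx).1 hg
  have hf' : IntegrableOn f (Set.Ioc 0 x) :=
    (intervalIntegrable_iff_integrableOn_Ioc_of_le hx).1 (hf.intervalIntegrable _ _)
  -- Both sides are iterated integrals of f(s)g(t) over the triangle t ≤ s, so Fubini applies.
  have hprod : Integrable (Function.uncurry fun s t : ℝ =>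
      Set.indicator {p : ℝ × ℝ | p.2 ≤ p.1} (fun p => f p.1 * g p.2) (s, t))
      ((volume.restrict (Set.Ioc 0 x)).prod (volume.restrict (Set.Ioc 0 x))) :=
    (hf'.mul_prod hg').indicator (measurableSet_le measurable_snd measurable_fst)
  have hswap := integral_integral_swap hprod
  rw [intervalIntegral.integral_of_le hx, intervalIntegral.integral_of_le hx]
  convert hswap using 1
  · refine setIntegral_congr_fun measurableSet_Ioc fun s hs => ?_
    rw [intervalIntegral.integral_of_le hs.1.le, ← integral_const_mul]
    have : (fun t => Set.indicator {p : ℝ × ℝ | p.2 ≤ p.1} (fun p => f p.1 * g p.2) (s, t))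
        = Set.indicator (Set.Iic s) fun t => f s * g t := by
      ext t; simp [Set.indicator_apply]
    rw [this, setIntegral_indicator measurableSet_Iic, Set.Ioc_inter_Iic, min_eq_right hs.2]
  · refine setIntegral_congr_fun measurableSet_Ioc fun t ht => ?_
    rw [intervalIntegral.integral_of_le ht.2, ← integral_mul_const]
    have : (fun s => Set.indicator {p : ℝ × ℝ | p.2 ≤ p.1} (fun p => f p.1 * g p.2) (s, t))
        = Set.indicator (Set.Ici t) fun s => f s * g t := by
      ext s; simp [Set.indicator_apply]
    rw [this, setIntegral_indicator measurableSet_Ici,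
      show Set.Ioc 0 x ∩ Set.Ici t = Set.Icc t x by
        ext s; simp only [Set.mem_inter_iff, Set.mem_Ioc, Set.mem_Ici, Set.mem_Icc]
        exact ⟨fun h => ⟨h.2, h.1.2⟩, fun h => ⟨⟨ht.1.trans_le h.1, h.2⟩, h.1⟩⟩,
      integral_Icc_eq_integral_Ioc]

/-- Variation of constants for a first order linear equation in integrated form. -/
theorem eq_exp_mul_add_integral {u h : ℝ → ℂ} {κ u₀ : ℂ} {x : ℝ} (hx : 0 ≤ x)
    (hu : ContinuousOn u (Set.Icc 0 x)) (hh : IntervalIntegrable h volume 0 x)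
    (heq : ∀ s ∈ Set.Icc 0 x, u s = u₀ + ∫ t in (0 : ℝ)..s, (κ * u t + h t)) :
    u x = Complex.exp (κ * x) * u₀ + ∫ t in (0 : ℝ)..x, Complex.exp (κ * (x - t)) * h t := by
  set E : ℝ → ℂ := fun s => Complex.exp (-κ * s) with hE
  have hEc : Continuous E := by fun_prop
  have hu' : IntervalIntegrable u volume 0 x :=
    ContinuousOn.intervalIntegrable (by rwa [Set.uIcc_of_le hx])
  have hg : IntervalIntegrable (fun t => κ * u t + h t) volume 0 x := (hu'.const_mul κ).add hh
  have hprim : ∀ a b : ℝ, ∫ s in a..b, -κ * E s = E b - E a := fun a b => by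
    refine intervalIntegral.integral_eq_sub_of_hasDerivAt (fun s _ => ?_)
      ((continuous_const.mul hEc).intervalIntegrable _ _)
    have := ((Complex.ofRealCLM.hasDerivAt (x := s)).const_mul (-κ)).cexp
    simpa [hE, mul_comm] using this
  -- The source is only integrable, so u need not be differentiable everywhere. Fubini replaces the
  -- product rule for the integrating factor E times u.
  have hparts := integral_mul_primitive hx (f := fun s => -κ * E s) (by fun_prop) hg
  simp only [hprim] at hparts
  have hEh : IntervalIntegrable (fun t => E t * h t) volume 0 x :=
    hh.continuousOn_mul hEc.continuousOn
  have hEu : IntervalIntegrable (fun t => E t * u t) volume 0 x :=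
    hu'.continuousOn_mul hEc.continuousOn
  have hEi : IntervalIntegrable E volume 0 x := hEc.intervalIntegrable _ _
  have hleft : ∫ s in (0 : ℝ)..x, -κ * E s * ∫ t in (0 : ℝ)..s, (κ * u t + h t)
      = -κ * (∫ s in (0 : ℝ)..x, E s * u s) - u₀ * (E x - 1) := by
    have h1 : ∫ s in (0 : ℝ)..x, -κ * E s * ∫ t in (0 : ℝ)..s, (κ * u t + h t)
        = ∫ s in (0 : ℝ)..x, (-κ * (E s * u s) - u₀ * (-κ * E s)) := by
      refine intervalIntegral.integral_congr fun s hs => ?_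
      rw [Set.uIcc_of_le hx] at hs
      rw [← sub_eq_iff_eq_add'.2 (heq s hs)]
      ring
    rw [h1, intervalIntegral.integral_sub (hEu.const_mul _) ((hEi.const_mul _).const_mul _),
      intervalIntegral.integral_const_mul, intervalIntegral.integral_const_mul, hprim]
    simp [hE]
  have hright : ∫ t in (0 : ℝ)..x, (E x - E t) * (κ * u t + h t)
      = E x * (u x - u₀) - κ * (∫ s in (0 : ℝ)..x, E s * u s) - ∫ t in (0 : ℝ)..x, E t * h t := by
    have h1 : ∫ t in (0 : ℝ)..x, (E x - E t) * (κ * u t + h t)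
        = ∫ t in (0 : ℝ)..x, (E x * (κ * u t + h t) - κ * (E t * u t) - E t * h t) := by
      congr 1; ext t; ring
    rw [h1, intervalIntegral.integral_sub ((hg.const_mul _).sub (hEu.const_mul _)) hEh,
      intervalIntegral.integral_sub (hg.const_mul _) (hEu.const_mul _),
      intervalIntegral.integral_const_mul, intervalIntegral.integral_const_mul,
      sub_eq_iff_eq_add'.2 (heq x ⟨hx, le_rfl⟩)]
  rw [hleft, hright] at hparts
  have hkey : E x * u x = u₀ + ∫ t in (0 : ℝ)..x, E t * h t := by linear_combination -hparts
  have hinv : Complex.exp (κ * x) * E x = 1 := by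
    rw [hE, ← Complex.exp_add]; simp
  have hexp : ∫ t in (0 : ℝ)..x, Complex.exp (κ * (x - t)) * h t
      = Complex.exp (κ * x) * ∫ t in (0 : ℝ)..x, E t * h t := by
    rw [← intervalIntegral.integral_const_mul]
    congr 1; ext t
    rw [hE, ← mul_assoc, ← Complex.exp_add]
    ring_nf
  rw [hexp, ← mul_add, ← hkey, ← mul_assoc, hinv, one_mul]

/-- Variation of constants: the first order combinations `y' + κ y` of a solution. -/
theorem IsSolution.derivWithin_add_mul {q y : ℝ → ℂ} {lam : ℂ}
    (hq : IntervalIntegrable q volume 0 1) (h : IsSolution q lam y) (κ : ℂ) {x : ℝ}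
    (hx : x ∈ Set.Icc (0 : ℝ) 1) :
    derivWithin y (Set.Icc 0 1) x + κ * y x
      = Complex.exp (κ * x) * (derivWithin y (Set.Icc 0 1) 0 + κ * y 0)
        + ∫ t in (0 : ℝ)..x, Complex.exp (κ * (x - t)) * ((q t - (lam + κ ^ 2)) * y t) := by
  have hyc := h.differentiableOn.continuousOn
  have hdc := h.continuousOn_derivWithin hq
  have hsub : ∀ {s : ℝ}, s ∈ Set.Icc (0 : ℝ) x → s ∈ Set.Icc (0 : ℝ) 1 := fun hs =>
    ⟨hs.1, hs.2.trans hx.2⟩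
  -- With u = y' + κy, the equation gives u' = κu + (q - λ - κ²)y. For κ = ±iω the coefficient of y
  -- becomes q - (λ - ω²).
  refine eq_exp_mul_add_integral hx.1
    (u := fun x => derivWithin y (Set.Icc 0 1) x + κ * y x)
    ((hdc.add (hyc.const_mul κ)).mono fun s hs => hsub hs)
    (intervalIntegrable_sub_const_mul hq _ hyc hx) fun s hs => ?_
  have hs1 := hsub hs
  have hy' : IntervalIntegrable (derivWithin y (Set.Icc 0 1)) volume 0 s := by
    refine ContinuousOn.intervalIntegrable ?_
    rw [Set.uIcc_of_le hs.1]
    exact hdc.mono (Set.Icc_subset_Icc_right hs1.2)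
  have e1 : ∫ t in (0 : ℝ)..s, (κ * (derivWithin y (Set.Icc 0 1) t + κ * y t)
        + (q t - (lam + κ ^ 2)) * y t)
      = ∫ t in (0 : ℝ)..s, ((q t - lam) * y t + κ * derivWithin y (Set.Icc 0 1) t) := by
    congr 1; ext t; ring
  rw [e1, intervalIntegral.integral_add (intervalIntegrable_sub_const_mul hq _ hyc hs1)
    (hy'.const_mul κ), intervalIntegral.integral_const_mul, h.deriv_eq s hs1,
    h.eq_add_integral hq hs1]
  ring

/-! ### High energy estimates -/

theorem norm_exp_ofReal_mul_I_mul (ω t : ℝ) : ‖Complex.exp ((ω * Complex.I) * t)‖ = 1 := by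
  rw [show (ω : ℂ) * Complex.I * t = ((ω * t : ℝ) : ℂ) * Complex.I by push_cast; ring]
  exact Complex.norm_exp_ofReal_mul_I _

theorem norm_integral_exp_mul_le {p y : ℝ → ℂ} (hp : IntervalIntegrable p volume 0 1)
    {ω m : ℝ} (hm : ∀ t ∈ Set.Icc (0 : ℝ) 1, ‖y t‖ ≤ m)
    {x : ℝ} (hx : x ∈ Set.Icc (0 : ℝ) 1) :
    ‖∫ t in (0 : ℝ)..x, Complex.exp ((ω * Complex.I) * (x - t)) * (p t * y t)‖
      ≤ (∫ t in (0 : ℝ)..1, ‖p t‖) * m := by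
  have hm0 : 0 ≤ m := (norm_nonneg _).trans (hm 0 ⟨le_rfl, zero_le_one⟩)
  have hsub : Set.uIcc 0 x ⊆ Set.uIcc (0 : ℝ) 1 := by
    rw [Set.uIcc_of_le hx.1, Set.uIcc_of_le zero_le_one]
    exact Set.Icc_subset_Icc_right hx.2
  calc _ ≤ ∫ t in (0 : ℝ)..x, ‖p t‖ * m := by
        refine intervalIntegral.norm_integral_le_of_norm_le hx.1 (ae_of_all _ fun t ht => ?_)
          ((hp.mono_set hsub).norm.mul_const m)
        have h1 := norm_exp_ofReal_mul_I_mul ω (x - t)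
        push_cast at h1
        rw [norm_mul, norm_mul, h1, one_mul]
        exact mul_le_mul_of_nonneg_left (hm t ⟨ht.1.le, ht.2.trans hx.2⟩) (norm_nonneg _)
    _ = (∫ t in (0 : ℝ)..x, ‖p t‖) * m := intervalIntegral.integral_mul_const _ _
    _ ≤ _ := by
        gcongr
        exact intervalIntegral.integral_mono_interval le_rfl hx.1 hx.2
          (ae_of_all _ fun _ => norm_nonneg _) hp.norm

/-- The distance of `y' + κ y`, `κ = iω`, from the corresponding free evolution. -/
theorem IsSolution.norm_sub_free_le {q y : ℝ → ℂ} {lam : ℂ}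
    (hq : IntervalIntegrable q volume 0 1) (h : IsSolution q lam y) {ω m : ℝ}
    (hm : ∀ t ∈ Set.Icc (0 : ℝ) 1, ‖y t‖ ≤ m) {x : ℝ} (hx : x ∈ Set.Icc (0 : ℝ) 1) :
    ‖derivWithin y (Set.Icc 0 1) x + ω * Complex.I * y x
      - Complex.exp ((ω * Complex.I) * x)
        * (derivWithin y (Set.Icc 0 1) 0 + ω * Complex.I * y 0)‖
      ≤ (∫ t in (0 : ℝ)..1, ‖q t - (lam - ω ^ 2)‖) * m := by
  rw [h.derivWithin_add_mul hq (ω * Complex.I) hx, add_sub_cancel_left]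
  have : ((ω : ℂ) * Complex.I) ^ 2 = -(ω : ℂ) ^ 2 := by rw [mul_pow, Complex.I_sq]; ring
  rw [this, ← sub_eq_add_neg]
  exact norm_integral_exp_mul_le (hq.sub intervalIntegrable_const) hm hx

theorem norm_add_ofReal_mul_I_mul_le (a b : ℂ) (ω : ℝ) :
    ‖b + ω * Complex.I * a‖ ≤ ‖b‖ + |ω| * ‖a‖ := by
  refine (norm_add_le _ _).trans_eq ?_
  simp

/-- A priori bound for solutions at high energy. -/
theorem IsSolution.norm_le {q y : ℝ → ℂ} {lam : ℂ}
    (hq : IntervalIntegrable q volume 0 1) (h : IsSolution q lam y) {ω : ℝ} (hω : 0 < |ω|)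
    (hP : 2 * ∫ t in (0 : ℝ)..1, ‖q t - (lam - ω ^ 2)‖ ≤ |ω|) {x : ℝ}
    (hx : x ∈ Set.Icc (0 : ℝ) 1) :
    ‖y x‖ ≤ 2 * (‖derivWithin y (Set.Icc 0 1) 0‖ + |ω| * ‖y 0‖) / |ω| := by
  obtain ⟨x₀, hx₀, hmax⟩ := isCompact_Icc.exists_isMaxOn ⟨x, hx⟩
    h.differentiableOn.continuousOn.norm
  refine (hmax hx).trans ?_
  set P := ∫ t in (0 : ℝ)..1, ‖q t - (lam - ω ^ 2)‖ with hPdef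
  set b := derivWithin y (Set.Icc 0 1) 0
  have h1 := h.norm_sub_free_le hq (ω := ω) (fun t ht => hmax ht) hx₀
  have h2 := h.norm_sub_free_le hq (ω := -ω) (fun t ht => hmax ht) hx₀
  have e1 : ‖Complex.exp ((ω * Complex.I) * x₀) * (b + ω * Complex.I * y 0)‖
      ≤ ‖b‖ + |ω| * ‖y 0‖ := by
    rw [norm_mul, norm_exp_ofReal_mul_I_mul, one_mul]
    exact norm_add_ofReal_mul_I_mul_le _ _ _
  have e2 : ‖Complex.exp (((-ω : ℝ) * Complex.I) * x₀) * (b + (-ω : ℝ) * Complex.I * y 0)‖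
      ≤ ‖b‖ + |ω| * ‖y 0‖ := by
    rw [norm_mul, norm_exp_ofReal_mul_I_mul, one_mul, ← abs_neg ω]
    exact norm_add_ofReal_mul_I_mul_le _ _ _
  have hsq : ((-ω : ℝ) : ℂ) ^ 2 = (ω : ℂ) ^ 2 := by push_cast; ring
  rw [hsq] at h2
  -- The difference of the relations for ω and -ω isolates 2iωy at a maximum point of ‖y‖. Since 2P
  -- ≤ |ω|, the term 2P‖y x₀‖ is absorbed on the left.
  have h3 : 2 * (|ω| * ‖y x₀‖) ≤ 2 * (‖b‖ + |ω| * ‖y 0‖) + 2 * (P * ‖y x₀‖) := by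
    have hnorm : 2 * (|ω| * ‖y x₀‖) = ‖2 * (ω * Complex.I * y x₀)‖ := by simp
    have n1 := norm_sub_norm_le
      (derivWithin y (Set.Icc 0 1) x₀ + ω * Complex.I * y x₀)
      (Complex.exp ((ω * Complex.I) * x₀) * (b + ω * Complex.I * y 0))
    have n2 := norm_sub_norm_le
      (derivWithin y (Set.Icc 0 1) x₀ + (-ω : ℝ) * Complex.I * y x₀)
      (Complex.exp (((-ω : ℝ) * Complex.I) * x₀) * (b + (-ω : ℝ) * Complex.I * y 0))
    have n3 := norm_sub_le (derivWithin y (Set.Icc 0 1) x₀ + ω * Complex.I * y x₀)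
      (derivWithin y (Set.Icc 0 1) x₀ + (-ω : ℝ) * Complex.I * y x₀)
    rw [hnorm, show 2 * (ω * Complex.I * y x₀)
      = (derivWithin y (Set.Icc 0 1) x₀ + ω * Complex.I * y x₀)
      - (derivWithin y (Set.Icc 0 1) x₀ + (-ω : ℝ) * Complex.I * y x₀) by push_cast; ring]
    linarith
  rw [le_div_iff₀ hω]
  nlinarith [norm_nonneg (y x₀)]

/-- End point values of a solution at a frequency `κ = iω` with `e^κ = -1`. -/
theorem IsSolution.norm_endpoint_le {q y : ℝ → ℂ} {lam : ℂ}
    (hq : IntervalIntegrable q volume 0 1) (h : IsSolution q lam y) {ω : ℝ} (hω : 0 < |ω|)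
    (hP : 2 * ∫ t in (0 : ℝ)..1, ‖q t - (lam - ω ^ 2)‖ ≤ |ω|)
    (hexp : Complex.exp (ω * Complex.I) = -1) :
    ‖derivWithin y (Set.Icc 0 1) 1 + ω * Complex.I * y 1
      + (derivWithin y (Set.Icc 0 1) 0 + ω * Complex.I * y 0)
        * (1 + (∫ t in (0 : ℝ)..1, (q t - (lam - ω ^ 2))) / (2 * (ω * Complex.I)))‖
      ≤ (‖derivWithin y (Set.Icc 0 1) 0‖ + |ω| * ‖y 0‖) / |ω|
        * (‖∫ t in (0 : ℝ)..1, Complex.exp (-(2 * (ω * Complex.I)) * t)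
            * (q t - (lam - ω ^ 2))‖ / 2
          + 2 * (∫ t in (0 : ℝ)..1, ‖q t - (lam - ω ^ 2)‖) ^ 2 / |ω|) := by
  set P := ∫ t in (0 : ℝ)..1, ‖q t - (lam - ω ^ 2)‖ with hPdef
  set a := y 0
  set b := derivWithin y (Set.Icc 0 1) 0
  set p : ℝ → ℂ := fun t => q t - (lam - ω ^ 2) with hp
  set κ : ℂ := ω * Complex.I with hκ
  set B := ‖b‖ + |ω| * ‖a‖ with hB
  have hpi : IntervalIntegrable p volume 0 1 := hq.sub intervalIntegrable_const
  have hκ0 : κ ≠ 0 := by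
    rw [hκ]; exact mul_ne_zero (by exact_mod_cast abs_pos.1 hω) Complex.I_ne_zero
  have hκn : ‖κ‖ = |ω| := by simp [hκ]
  have hκ2 : κ ^ 2 = -(ω : ℂ) ^ 2 := by rw [hκ, mul_pow, Complex.I_sq]; ring
  -- The free solution of -y'' = ω²y with the initial data of y; it replaces y in the source at a
  -- relative cost of order P/|ω|.
  set y₀ : ℝ → ℂ := fun t =>
    (Complex.exp (κ * t) * (b + κ * a) - Complex.exp (-κ * t) * (b - κ * a)) / (2 * κ) with hy₀
  have hm : ∀ t ∈ Set.Icc (0 : ℝ) 1, ‖y t‖ ≤ 2 * B / |ω| := fun t ht => h.norm_le hq hω hP ht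
  have happrox : ∀ t ∈ Set.Icc (0 : ℝ) 1, ‖y t - y₀ t‖ ≤ P * (2 * B / |ω|) / |ω| := by
    intro t ht
    have h1 := h.norm_sub_free_le hq (ω := ω) hm ht
    have h2 := h.norm_sub_free_le hq (ω := -ω) hm ht
    have hsq : ((-ω : ℝ) : ℂ) ^ 2 = (ω : ℂ) ^ 2 := by push_cast; ring
    rw [hsq] at h2
    have hneg : ((-ω : ℝ) : ℂ) * Complex.I = -κ := by rw [hκ]; push_cast; ring
    rw [hneg] at h2
    have h3 := (norm_sub_le _ _).trans (add_le_add h1 h2)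
    have h4 : y t - y₀ t = ((derivWithin y (Set.Icc 0 1) t + κ * y t
          - Complex.exp (κ * t) * (b + κ * a))
        - (derivWithin y (Set.Icc 0 1) t + -κ * y t
          - Complex.exp (-κ * t) * (b + -κ * a))) / (2 * κ) := by
      rw [hy₀]; field_simp; ring
    rw [h4, norm_div, norm_mul, hκn, RCLike.norm_ofNat, div_le_div_iff₀ (by positivity) hω]
    nlinarith
  have hrep := h.derivWithin_add_mul hq κ (x := 1) ⟨zero_le_one, le_rfl⟩
  rw [hκ2, ← sub_eq_add_neg, Complex.ofReal_one, mul_one, hexp] at hrep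
  have hy₀c : Continuous y₀ := by rw [hy₀]; fun_prop
  have hexpc : Continuous fun t : ℝ => Complex.exp (κ * (1 - t)) := by fun_prop
  have hi1 : IntervalIntegrable (fun t => Complex.exp (κ * (1 - t)) * (p t * (y t - y₀ t)))
      volume 0 1 := by
    refine IntervalIntegrable.continuousOn_mul (hpi.mul_continuousOn ?_) hexpc.continuousOn
    rw [Set.uIcc_of_le zero_le_one]
    exact h.differentiableOn.continuousOn.sub hy₀c.continuousOn
  have hi2 : IntervalIntegrable (fun t => Complex.exp (κ * (1 - t)) * (p t * y₀ t))
      volume 0 1 :=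
    (hpi.mul_continuousOn hy₀c.continuousOn).continuousOn_mul hexpc.continuousOn
  have hi3 : IntervalIntegrable (fun t : ℝ => Complex.exp (-(2 * κ) * t) * p t) volume 0 1 :=
    hpi.continuousOn_mul (Continuous.continuousOn (by fun_prop))
  have hsplit : ∫ t in (0 : ℝ)..1, Complex.exp (κ * (1 - t)) * (p t * y t)
      = (∫ t in (0 : ℝ)..1, Complex.exp (κ * (1 - t)) * (p t * (y t - y₀ t)))
        + ∫ t in (0 : ℝ)..1, Complex.exp (κ * (1 - t)) * (p t * y₀ t) := by
    rw [← intervalIntegral.integral_add hi1 hi2]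
    congr 1; ext t; ring
  -- By e^κ = -1, one exponential of y₀ combines with e^{κ(1-t)} to the constant -1 and yields the
  -- mean of p; the other one leaves the oscillation e^{-2κt}.
  have hmain : ∫ t in (0 : ℝ)..1, Complex.exp (κ * (1 - t)) * (p t * y₀ t)
      = -((b + κ * a) / (2 * κ)) * (∫ t in (0 : ℝ)..1, p t)
        + (b - κ * a) / (2 * κ) * ∫ t in (0 : ℝ)..1, Complex.exp (-(2 * κ) * t) * p t := by
    rw [← intervalIntegral.integral_const_mul, ← intervalIntegral.integral_const_mul,
      ← intervalIntegral.integral_add (hpi.const_mul _) (hi3.const_mul _)]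
    congr 1; ext t
    have e1 : Complex.exp (κ * (1 - t)) * Complex.exp (κ * t) = -1 := by
      rw [← Complex.exp_add, ← hexp]; congr 1; ring
    have e2 : Complex.exp (κ * (1 - t)) * Complex.exp (-κ * t)
        = -Complex.exp (-(2 * κ) * t) := by
      rw [← neg_one_mul (Complex.exp (-(2 * κ) * t)), ← hexp, ← Complex.exp_add,
        ← Complex.exp_add]
      congr 1; ring
    rw [hy₀]
    linear_combination (p t * (b + κ * a) / (2 * κ)) * e1 - (p t * (b - κ * a) / (2 * κ)) * e2
  have hfinal : derivWithin y (Set.Icc 0 1) 1 + κ * y 1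
      + (b + κ * a) * (1 + (∫ t in (0 : ℝ)..1, p t) / (2 * κ))
      = (b - κ * a) / (2 * κ) * (∫ t in (0 : ℝ)..1, Complex.exp (-(2 * κ) * t) * p t)
        + ∫ t in (0 : ℝ)..1, Complex.exp (κ * (1 - t)) * (p t * (y t - y₀ t)) := by
    rw [hrep]
    linear_combination hsplit + hmain
  rw [hfinal]
  have hb : ‖b - κ * a‖ ≤ B := by
    have := norm_add_ofReal_mul_I_mul_le a b (-ω)
    rw [abs_neg] at this
    rwa [show b - κ * a = b + ((-ω : ℝ) : ℂ) * Complex.I * a by rw [hκ]; push_cast; ring]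
  have herr := norm_integral_exp_mul_le hpi (ω := ω) happrox ⟨zero_le_one, le_rfl⟩
  rw [Complex.ofReal_one] at herr
  calc _ ≤ B / (2 * |ω|) * ‖∫ t in (0 : ℝ)..1, Complex.exp (-(2 * κ) * t) * p t‖
        + P * (P * (2 * B / |ω|) / |ω|) := by
        refine (norm_add_le _ _).trans (add_le_add ?_ herr)
        rw [norm_mul, norm_div, norm_mul, hκn, RCLike.norm_ofNat]
        gcongr
    _ = _ := by simp only [hp]; field_simp

/-! ### End point asymptotics -/

/-- Riemann–Lebesgue lemma on `[0,1]`. -/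
theorem tendsto_integral_exp_mul {ι : Type*} {F : Filter ι} {ω : ι → ℝ}
    (hω : Tendsto ω F (cocompact ℝ)) {q : ℝ → ℂ} :
    Tendsto (fun x => ∫ t in (0 : ℝ)..1, Complex.exp (-(2 * (ω x * Complex.I)) * t) * q t)
      F (nhds 0) := by
  have h := Real.tendsto_integral_exp_smul_cocompact (Set.indicator (Set.Ioc (0 : ℝ) 1) q)
  -- The Fourier character is e^{-2πitw}, so e^{-2iωt} corresponds to w = ω/π.
  have hω' : Tendsto (fun x => ω x / Real.pi) F (cocompact ℝ) := by
    have := (Homeomorph.mulRight₀ (Real.pi)⁻¹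
      (inv_ne_zero Real.pi_ne_zero)).isClosedEmbedding.tendsto_cocompact
    exact this.comp hω
  refine (h.comp hω').congr fun x => ?_
  rw [intervalIntegral.integral_of_le zero_le_one, ← integral_indicator measurableSet_Ioc,
    Function.comp_apply]
  congr 1; ext t
  by_cases ht : t ∈ Set.Ioc (0 : ℝ) 1
  · simp only [Set.indicator_of_mem ht, Circle.smul_def, Real.fourierChar_apply, smul_eq_mul]
    congr 2
    push_cast
    field_simp
  · simp [Set.indicator_of_notMem ht]

section

variable {ι : Type*} {F : Filter ι} {ω : ι → ℝ} {lam : ι → ℂ} {q : ℝ → ℂ}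

theorem isBigO_integral_norm_sub (hq : IntervalIntegrable q volume 0 1)
    (hlam : (fun x => lam x - (ω x : ℂ) ^ 2) =O[F] fun _ => (1 : ℝ)) :
    (fun x => ∫ t in (0 : ℝ)..1, ‖q t - (lam x - (ω x : ℂ) ^ 2)‖) =O[F] fun _ => (1 : ℝ) := by
  have hbd : (fun x => (∫ t in (0 : ℝ)..1, ‖q t‖) + ‖lam x - (ω x : ℂ) ^ 2‖)
      =O[F] fun _ => (1 : ℝ) := (isBigO_const_const _ one_ne_zero _).add hlam.norm_left
  refine (IsBigO.of_norm_le fun x => ?_).trans hbd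
  rw [Real.norm_of_nonneg (intervalIntegral.integral_nonneg zero_le_one fun _ _ => norm_nonneg _)]
  calc _ ≤ ∫ t in (0 : ℝ)..1, (‖q t‖ + ‖lam x - (ω x : ℂ) ^ 2‖) :=
        intervalIntegral.integral_mono_on zero_le_one
          (hq.sub intervalIntegrable_const).norm (hq.norm.add intervalIntegrable_const)
          fun t _ => norm_sub_le _ _
    _ = _ := by
        rw [intervalIntegral.integral_add hq.norm intervalIntegrable_const]
        simp

/-- The integrand varies with the parameter only through a bounded additive constant, so
Riemann–Lebesgue for the two fixed functions q and 1 suffices. -/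
theorem tendsto_integral_exp_mul_sub (hq : IntervalIntegrable q volume 0 1)
    (hω : Tendsto ω F (cocompact ℝ))
    (hlam : (fun x => lam x - (ω x : ℂ) ^ 2) =O[F] fun _ => (1 : ℝ)) :
    Tendsto (fun x => ∫ t in (0 : ℝ)..1, Complex.exp (-(2 * (ω x * Complex.I)) * t)
      * (q t - (lam x - (ω x : ℂ) ^ 2))) F (nhds 0) := by
  have h1 := tendsto_integral_exp_mul hω (q := q)
  have h2 := tendsto_integral_exp_mul hω (q := fun _ => 1)
  have h3 : Tendsto (fun x => (lam x - (ω x : ℂ) ^ 2) *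
      ∫ t in (0 : ℝ)..1, Complex.exp (-(2 * (ω x * Complex.I)) * t) * (1 : ℂ)) F (nhds 0) := by
    rw [← isLittleO_one_iff ℝ] at h2 ⊢
    simpa using hlam.mul_isLittleO h2
  have h4 := h1.sub h3
  rw [sub_zero] at h4
  refine h4.congr fun x => ?_
  have hexp : Continuous fun t : ℝ => Complex.exp (-(2 * (ω x * Complex.I)) * t) := by fun_prop
  rw [← intervalIntegral.integral_const_mul, ← intervalIntegral.integral_sub
    (hq.continuousOn_mul hexp.continuousOn)
    ((Continuous.intervalIntegrable (by fun_prop) _ _).const_mul _)]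
  congr 1; ext t; ring

/-- Asymptotics of the end point values of solutions for `lam = ω² + O(1)`, `e^{iω} = -1`. -/
theorem isLittleO_endpoint (hq : IntervalIntegrable q volume 0 1)
    (hω : Tendsto (fun x => |ω x|) F atTop)
    (hexp : ∀ x, Complex.exp (ω x * Complex.I) = -1)
    (hlam : (fun x => lam x - (ω x : ℂ) ^ 2) =O[F] fun _ => (1 : ℝ))
    {y : ι → ℝ → ℂ} (hy : ∀ x, IsSolution q (lam x) (y x)) :
    (fun x => derivWithin (y x) (Set.Icc 0 1) 1 + ω x * Complex.I * y x 1
      + (derivWithin (y x) (Set.Icc 0 1) 0 + ω x * Complex.I * y x 0)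
        * (1 + (∫ t in (0 : ℝ)..1, (q t - (lam x - (ω x : ℂ) ^ 2))) / (2 * (ω x * Complex.I))))
      =o[F] fun x => (‖derivWithin (y x) (Set.Icc 0 1) 0‖ + |ω x| * ‖y x 0‖) / |ω x| := by
  have hco : Tendsto ω F (cocompact ℝ) := by
    rw [← Metric.cobounded_eq_cocompact, ← tendsto_norm_atTop_iff_cobounded]
    exact hω
  have hP := isBigO_integral_norm_sub hq hlam
  have hR := (tendsto_integral_exp_mul_sub hq hco hlam).norm
  have hinv : (fun x => |ω x|⁻¹) =o[F] fun _ => (1 : ℝ) :=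
    (isLittleO_one_iff ℝ).2 hω.inv_tendsto_atTop
  -- The relative error in `IsSolution.norm_endpoint_le`: a Riemann–Lebesgue term and a second order
  -- term of size 1/|ω|.
  set ρ : ι → ℝ := fun x => ‖∫ t in (0 : ℝ)..1, Complex.exp (-(2 * (ω x * Complex.I)) * t)
        * (q t - (lam x - (ω x : ℂ) ^ 2))‖ / 2
      + 2 * (∫ t in (0 : ℝ)..1, ‖q t - (lam x - (ω x : ℂ) ^ 2)‖) ^ 2 / |ω x| with hρdef
  have hρ : ρ =o[F] fun _ => (1 : ℝ) := by
    refine IsLittleO.add ?_ ?_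
    · rw [isLittleO_one_iff]
      simpa using hR.div_const 2
    · have := (((hP.pow 2).const_mul_left 2).mul_isLittleO hinv)
      simpa [div_eq_mul_inv] using this
  have hlarge : ∀ᶠ x in F, 0 < |ω x| ∧
      2 * ∫ t in (0 : ℝ)..1, ‖q t - (lam x - (ω x : ℂ) ^ 2)‖ ≤ |ω x| := by
    obtain ⟨C, hC⟩ := hP.bound
    filter_upwards [hC, hω.eventually_gt_atTop 0, hω.eventually_ge_atTop (2 * C)]
      with x h1 h2 h3
    refine ⟨h2, ?_⟩
    rw [Real.norm_eq_abs, norm_one, mul_one] at h1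
    linarith [le_abs_self (∫ t in (0 : ℝ)..1, ‖q t - (lam x - (ω x : ℂ) ^ 2)‖)]
  refine (IsBigO.of_bound 1 ?_ : _ =O[F] fun x =>
    (‖derivWithin (y x) (Set.Icc 0 1) 0‖ + |ω x| * ‖y x 0‖) / |ω x| * ρ x).trans_isLittleO ?_
  · filter_upwards [hlarge] with x hx
    have := (hy x).norm_endpoint_le hq hx.1 hx.2 (hexp x)
    rw [one_mul]
    exact this.trans (le_abs_self _)
  · simpa using (isBigO_refl _ F).mul_isLittleO hρ

theorem intervalIntegral_sub_const (hq : IntervalIntegrable q volume 0 1) (c : ℂ) :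
    ∫ t in (0 : ℝ)..1, (q t - c) = (∫ t in (0 : ℝ)..1, q t) - c := by
  rw [intervalIntegral.integral_sub hq intervalIntegrable_const]
  simp

/-- With p = ∫q - (λ - ω²), the end point relation reads c'(1) ± iω(c(1) + 1) + p/2 = o(1) for the
frequencies ±ω. The difference controls c(1) + 1, the sum controls c'(1). -/
theorem cosSol_asymptotics (hq : IntervalIntegrable q volume 0 1) (hω : Tendsto ω F atTop)
    (hexp : ∀ x, Complex.exp (ω x * Complex.I) = -1)
    (hlam : (fun x => lam x - (ω x : ℂ) ^ 2) =O[F] fun _ => (1 : ℝ)) :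
    (fun x => (ω x : ℂ) * (cosSol q (lam x) 1 + 1)) =o[F] (fun _ => (1 : ℝ)) ∧
      (fun x => cosSolDerivOne q (lam x)) =O[F] fun _ => (1 : ℝ) := by
  have hspec := fun x => ivpSolution_spec hq (lam x) 1 0
  have h1 := isLittleO_endpoint hq (tendsto_abs_atTop_atTop.comp hω) hexp hlam
    fun x => (hspec x).1
  have h2 := isLittleO_endpoint hq (ω := fun x => -ω x)
    (by simpa [Function.comp_def] using tendsto_abs_atTop_atTop.comp hω)
    (fun x => by
      push_cast
      rw [neg_mul, Complex.exp_neg, hexp x]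
      norm_num)
    (by simpa using hlam) fun x => (hspec x).1
  have hpos := hω.eventually_gt_atTop 0
  have hB : (fun x => (‖derivWithin (ivpSolution q (lam x) 1 0) (Set.Icc 0 1) 0‖
      + |ω x| * ‖ivpSolution q (lam x) 1 0 0‖) / |ω x|) =ᶠ[F] fun _ => (1 : ℝ) := by
    filter_upwards [hpos] with x hx
    rw [(hspec x).2.1, (hspec x).2.2]
    simp [hx.ne']
  have h1' := h1.trans_isBigO hB.isBigO
  simp only [abs_neg] at h2
  have h2' := h2.trans_isBigO hB.isBigO
  constructor
  · refine (((h1'.sub h2').const_mul_left (-Complex.I / 2)).congr' ?_ EventuallyEq.rfl)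
    filter_upwards [hpos] with x hx
    have hx' : (ω x : ℂ) ≠ 0 := by exact_mod_cast hx.ne'
    rw [(hspec x).2.1, (hspec x).2.2, cosSol]
    push_cast
    rw [neg_sq, intervalIntegral_sub_const hq]
    have hI := Complex.I_ne_zero
    field_simp
    ring_nf
    simp only [Complex.I_sq]
    ring
  · have hp : (fun x => (1 / 2 : ℂ) * ((∫ t in (0 : ℝ)..1, q t) - (lam x - (ω x : ℂ) ^ 2)))
        =O[F] fun _ => (1 : ℝ) :=
      (((isBigO_const_const _ one_ne_zero _).sub hlam).const_mul_left _)
    refine (((h1'.add h2').const_mul_left (1 / 2)).isBigO.sub hp).congr' ?_ EventuallyEq.rfl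
    filter_upwards [hpos] with x hx
    have hx' : (ω x : ℂ) ≠ 0 := by exact_mod_cast hx.ne'
    rw [(hspec x).2.1, (hspec x).2.2, cosSolDerivOne, cosSol]
    push_cast
    rw [neg_sq, intervalIntegral_sub_const hq]
    have hI := Complex.I_ne_zero
    field_simp
    ring

/-- Here y(0) = 0 improves the error by a factor 1/ω: s'(1) + 1 ± (iωs(1) + p/(2iω)) = o(1/ω), with
p = ∫q - (λ - ω²). Sum and difference separate the two quantities. -/
theorem sinSol_asymptotics (hq : IntervalIntegrable q volume 0 1) (hω : Tendsto ω F atTop)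
    (hexp : ∀ x, Complex.exp (ω x * Complex.I) = -1)
    (hlam : (fun x => lam x - (ω x : ℂ) ^ 2) =O[F] fun _ => (1 : ℝ)) :
    (fun x => (ω x : ℂ) * (sinSolDerivOne q (lam x) + 1)) =o[F] (fun _ => (1 : ℝ)) ∧
      (fun x => (ω x : ℂ) ^ 2 * sinSol q (lam x) 1
        - ((∫ t in (0 : ℝ)..1, q t) - (lam x - (ω x : ℂ) ^ 2)) / 2) =o[F] fun _ => (1 : ℝ) := by
  have hspec := fun x => ivpSolution_spec hq (lam x) 0 1
  have h1 := isLittleO_endpoint hq (tendsto_abs_atTop_atTop.comp hω) hexp hlam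
    fun x => (hspec x).1
  have h2 := isLittleO_endpoint hq (ω := fun x => -ω x)
    (by simpa [Function.comp_def] using tendsto_abs_atTop_atTop.comp hω)
    (fun x => by
      push_cast
      rw [neg_mul, Complex.exp_neg, hexp x]
      norm_num)
    (by simpa using hlam) fun x => (hspec x).1
  have hpos := hω.eventually_gt_atTop 0
  have hB : (fun x => ω x * ((‖derivWithin (ivpSolution q (lam x) 0 1) (Set.Icc 0 1) 0‖
      + |ω x| * ‖ivpSolution q (lam x) 0 1 0‖) / |ω x|))
      =ᶠ[F] fun _ => (1 : ℝ) := by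
    filter_upwards [hpos] with x hx
    rw [(hspec x).2.1, (hspec x).2.2, abs_of_pos hx]
    simp [hx.ne']
  have hωO : (fun x => (ω x : ℂ)) =O[F] ω := isBigO_of_le _ fun x => by rw [Complex.norm_real]
  have key : ∀ f : ι → ℂ, f =o[F] (fun x =>
      (‖derivWithin (ivpSolution q (lam x) 0 1) (Set.Icc 0 1) 0‖
      + |ω x| * ‖ivpSolution q (lam x) 0 1 0‖) / |ω x|) →
      (fun x => (ω x : ℂ) * f x) =o[F] fun _ => (1 : ℝ) := fun f hf =>
    (hωO.mul_isLittleO hf).trans_isBigO hB.isBigO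
  have h1' := key _ h1
  have h2' := key _ (by simpa using h2)
  constructor
  · refine (((h1'.add h2').const_mul_left (1 / 2)).congr' ?_ EventuallyEq.rfl)
    filter_upwards [hpos] with x hx
    have hx' : (ω x : ℂ) ≠ 0 := by exact_mod_cast hx.ne'
    rw [(hspec x).2.1, (hspec x).2.2, sinSolDerivOne, sinSol]
    have hI := Complex.I_ne_zero
    field_simp
    ring
  · refine (((h1'.sub h2').const_mul_left (-Complex.I / 2)).congr' ?_ EventuallyEq.rfl)
    filter_upwards [hpos] with x hx
    have hx' : (ω x : ℂ) ≠ 0 := by exact_mod_cast hx.ne'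
    rw [(hspec x).2.1, (hspec x).2.2, sinSol, intervalIntegral_sub_const hq]
    have hI := Complex.I_ne_zero
    field_simp
    ring_nf
    simp only [Complex.I_sq]
    ring

end
-- Block determinants
open Matrix

section Blocks

variable {K S U R : Type*} [Field K] [Fintype S] [DecidableEq S] [Fintype U] [DecidableEq U]
  [Fintype R] [DecidableEq R]

theorem det_fromBlocks_zero₁₁ (B C D : Matrix S S K) :
    (fromBlocks 0 B C D).det = (-1) ^ Fintype.card S * B.det * C.det := by
  -- A unipotent factor turns the block swap into a matrix with an identity corner, whose Schur
  -- complement is -1.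
  have hJ : (fromBlocks 0 1 1 0 : Matrix (S ⊕ S) (S ⊕ S) K).det = (-1) ^ Fintype.card S := by
    have h : (fromBlocks 1 1 0 1 : Matrix (S ⊕ S) (S ⊕ S) K) * fromBlocks 0 1 1 0
        = fromBlocks 1 1 1 0 := by simp [fromBlocks_multiply]
    have := congrArg det h
    rw [det_mul, det_fromBlocks_zero₂₁, det_fromBlocks_one₁₁] at this
    simpa [det_neg] using this
  have h : fromBlocks 0 B C D
      = (fromBlocks B 0 D C : Matrix (S ⊕ S) (S ⊕ S) K) * fromBlocks 0 1 1 0 := by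
    simp [fromBlocks_multiply]
  rw [h, det_mul, hJ, det_fromBlocks_zero₁₂]
  ring

/-- Elimination of an invertible block `T` from a saddle point matrix, where the columns of
`(α, 1)` are annihilated by the rows `(T, τ)`. -/
theorem det_saddle_eliminate (T D : Matrix S S K) (τ α : Matrix S R K) (σ : Matrix U S K)
    (ρ : Matrix U R K) (Δ : Matrix R R K) (hT : IsUnit T.det) (hα : T * α + τ = 0) :
    (fromBlocks (fromBlocks 0 T Tᵀ D) (fromBlocks 0 τ σᵀ 0)
      (fromBlocks 0 σ τᵀ 0) (fromBlocks 0 ρ ρᵀ Δ)).det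
      = (-1) ^ Fintype.card S * T.det ^ 2
        * (fromBlocks 0 (σ * α + ρ) (σ * α + ρ)ᵀ (αᵀ * D * α + Δ)).det := by
  have hTt : IsUnit Tᵀ.det := by rwa [det_transpose]
  have hdet : (fromBlocks 0 T Tᵀ D).det = (-1) ^ Fintype.card S * T.det ^ 2 := by
    rw [det_fromBlocks_zero₁₁, det_transpose]; ring
  have hX : IsUnit (fromBlocks 0 T Tᵀ D).det := by
    rw [hdet]
    exact ((isUnit_one.neg).pow _).mul (hT.pow 2)
  let := invertibleOfIsUnitDet _ hX
  have hτ : τ = -(T * α) := (neg_eq_of_add_eq_zero_right hα).symm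
  -- As τ = -Tα, the pivot block applied to this explicit matrix gives the off-diagonal block, so
  -- the Schur complement needs no inverse of the full pivot.
  have hsolve : (fromBlocks 0 T Tᵀ D) * fromBlocks (Tᵀ⁻¹ * σᵀ) (Tᵀ⁻¹ * (D * α)) 0 (-α)
      = fromBlocks 0 τ σᵀ 0 := by
    rw [fromBlocks_multiply, hτ]
    simp [mul_nonsing_inv_cancel_left _ _ hTt]
  rw [det_fromBlocks₁₁, hdet, ← hsolve, Matrix.mul_assoc (fromBlocks 0 σ τᵀ 0),
    Matrix.invOf_mul_cancel_left]
  congr 2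
  rw [fromBlocks_multiply, hτ]
  simp only [transpose_neg, transpose_mul, Matrix.neg_mul, Matrix.mul_assoc,
    mul_nonsing_inv_cancel_left _ _ hTt, transpose_add,
    sub_eq_add_neg, fromBlocks_neg, fromBlocks_add]
  simp [add_comm]

end Blocks

/-- Determinant of a diagonal matrix bordered by a constant row and column. -/
theorem det_bordered_diagonal {R : Type*} [Fintype R] [DecidableEq R] (c : ℂ) (Δ : R → ℂ) :
    (fromBlocks 0 (of fun _ _ => c) (of fun _ _ => c) (diagonal Δ) :
      Matrix (Unit ⊕ R) (Unit ⊕ R) ℂ).det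
      = -c ^ 2 * ∑ i, ∏ j ∈ Finset.univ.erase i, Δ j := by
  have key : ∀ Δ : R → ℂ, (∀ j, Δ j ≠ 0) →
      (fromBlocks 0 (of fun _ _ => c) (of fun _ _ => c) (diagonal Δ) :
        Matrix (Unit ⊕ R) (Unit ⊕ R) ℂ).det
        = -c ^ 2 * ∑ i, ∏ j ∈ Finset.univ.erase i, Δ j := by
    intro Δ hΔ
    let : Invertible (diagonal Δ) := invertibleOfRightInverse _ (diagonal fun j => (Δ j)⁻¹) (by
      rw [diagonal_mul_diagonal, ← diagonal_one]
      congr 1; ext j; exact mul_inv_cancel₀ (hΔ j))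
    have hinv : ⅟(diagonal Δ) = diagonal fun j => (Δ j)⁻¹ := rfl
    rw [det_fromBlocks₂₂, hinv, det_diagonal, det_unique, Finset.mul_sum, zero_sub,
      Matrix.neg_apply, Matrix.mul_apply, mul_neg, Finset.mul_sum, ← Finset.sum_neg_distrib]
    refine Finset.sum_congr rfl fun i _ => ?_
    rw [← Finset.mul_prod_erase _ _ (Finset.mem_univ i)]
    simp only [mul_diagonal, of_apply]
    field_simp [hΔ i]
  -- Both sides are continuous in a common shift t of the diagonal; all but finitely many t make it
  -- invertible, and t = 0 follows by density.
  have hdense : Dense {t : ℂ | ∀ j, Δ j + t ≠ 0} := by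
    have hfin : (Set.range fun j => -Δ j).Finite := Set.finite_range _
    refine (hfin.countable.dense_compl ℂ).mono fun t ht => ?_
    exact fun j hj => ht ⟨j, by linear_combination -hj⟩
  have hext := Continuous.ext_on hdense
    (f := fun t : ℂ => (fromBlocks 0 (of fun _ _ => c) (of fun _ _ => c)
      (diagonal fun j => Δ j + t) : Matrix (Unit ⊕ R) (Unit ⊕ R) ℂ).det)
    (g := fun t : ℂ => -c ^ 2 * ∑ i, ∏ j ∈ Finset.univ.erase i, (Δ j + t))
    (by
      refine Continuous.matrix_det (Continuous.matrix_fromBlocks continuous_const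
        continuous_const continuous_const (Continuous.matrix_diagonal ?_))
      fun_prop) (by fun_prop) fun t ht => key _ ht
  simpa using congrFun hext 0

/-! ### The incidence matrix of the glued odd cycles -/

/-- The unsigned incidence matrix; a loop contributes `2`. -/
def unsignedIncidence {V E : Type*} [DecidableEq V] (G : OrientedGraph V E) : Matrix V E ℂ :=
  of fun v e => (if G.tgt e = v then 1 else 0) + (if G.src e = v then 1 else 0)

section Glued

variable {r : ℕ} {N : Fin r → ℕ}

theorem unsignedIncidence_gluedCycles (n : Fin r → ℕ) (fwd : GluedEdge n → Bool)
    (v : GluedVertex n) (e : GluedEdge n) :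
    unsignedIncidence (gluedCycles n fwd) v e
      = (if gluedVertex n e.1 e.2 = v then 1 else 0)
        + (if gluedVertex n e.1 (e.2 + 1) = v then 1 else 0) := by
  simp only [unsignedIncidence, gluedCycles, of_apply]
  by_cases h : fwd e = true
  · simp [h, add_comm]
  · simp [h]

/-- The alternating vectors on the cycles, as the columns of a matrix. -/
def alternatingColumns (n : Fin r → ℕ) : Matrix (GluedEdge n) (Fin r) ℂ :=
  of fun e j => if e.1 = j then (-1) ^ (e.2 : ℕ) else 0

theorem sum_mul_alternatingColumns (n : Fin r → ℕ) (f : GluedEdge n → ℂ) (j : Fin r) :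
    ∑ e, f e * alternatingColumns n e j = ∑ l : Fin (n j), f ⟨j, l⟩ * (-1) ^ (l : ℕ) := by
  rw [Fintype.sum_sigma, Finset.sum_eq_single j]
  · simp [alternatingColumns]
  · intro i _ hi
    simp [alternatingColumns, hi]
  · simp

/-- The alternating sum telescopes along the cycle to its first minus its signed last vertex. Both
are the common vertex, and for odd length the last sign is -1, so the two contributions add to 2
instead of cancelling. -/
theorem unsignedIncidence_mul_alternatingColumns {n : Fin r → ℕ} (hn : ∀ j, Odd (n j))
    (fwd : GluedEdge n → Bool) :
    unsignedIncidence (gluedCycles n fwd) * alternatingColumns n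
      = of fun v _ => if v = none then 2 else 0 := by
  ext v j
  rw [mul_apply, sum_mul_alternatingColumns]
  simp only [unsignedIncidence_gluedCycles, of_apply]
  set g : ℕ → ℂ := fun l => if gluedVertex n j l = v then 1 else 0 with hg
  have h1 : ∑ l : Fin (n j), ((if gluedVertex n j l = v then (1 : ℂ) else 0)
      + (if gluedVertex n j (l + 1) = v then 1 else 0)) * (-1) ^ (l : ℕ)
      = ∑ l ∈ Finset.range (n j), ((-1) ^ l * g l - (-1) ^ (l + 1) * g (l + 1)) := by
    rw [← Fin.sum_univ_eq_sum_range]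
    refine Finset.sum_congr rfl fun l _ => ?_
    simp only [hg, pow_succ]
    ring
  have h0 : g 0 = if v = none then 1 else 0 := by simp [hg, gluedVertex, eq_comm]
  have h2 : g (n j) = if v = none then 1 else 0 := by simp [hg, gluedVertex, eq_comm]
  rw [h1, Finset.sum_range_sub', (hn j).neg_one_pow, h0, h2]
  split_ifs <;> norm_num

/-- Different columns have disjoint supports, and the signs square to 1. -/
theorem alternatingColumns_conj_diagonal (n : Fin r → ℕ) (d : GluedEdge n → ℂ) :
    (alternatingColumns n)ᵀ * diagonal d * alternatingColumns n
      = diagonal fun j => ∑ l : Fin (n j), d ⟨j, l⟩ := by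
  ext i j
  rw [mul_apply, sum_mul_alternatingColumns]
  simp only [mul_diagonal, transpose_apply, alternatingColumns, of_apply]
  by_cases h : i = j
  · subst h
    rw [diagonal_apply_eq]
    refine Finset.sum_congr rfl fun l _ => ?_
    rw [if_pos rfl, mul_right_comm, ← mul_pow]
    norm_num
  · rw [diagonal_apply_ne _ h]
    exact Finset.sum_eq_zero fun l _ => by rw [if_neg (Ne.symm h)]; ring

/-- Vertices and edges of the glued cycles: every interior vertex `v_{j,l+1}` is paired with the
edge leaving it, and the common vertex and the first edges of the cycles remain. -/
def gluedIndex (N : Fin r → ℕ) :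
    (((j : Fin r) × Fin (N j)) ⊕ ((j : Fin r) × Fin (N j))) ⊕ (Unit ⊕ Fin r)
      ≃ GluedVertex (fun j => N j + 1) ⊕ GluedEdge (fun j => N j + 1) where
  toFun
    | .inl (.inl s) => .inl (some s)
    | .inl (.inr s) => .inr ⟨s.1, s.2.succ⟩
    | .inr (.inl _) => .inl none
    | .inr (.inr j) => .inr ⟨j, 0⟩
  invFun
    | .inl (some s) => .inl (.inl s)
    | .inl none => .inr (.inl ())
    | .inr ⟨j, l⟩ => Fin.cases (motive := fun _ => _) (.inr (.inr j)) (fun l => .inl (.inr ⟨j, l⟩)) l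
  left_inv := by rintro ((s | s) | (u | j)) <;> rfl
  right_inv := by
    rintro ((_ | s) | ⟨j, l⟩)
    · rfl
    · rfl
    · induction l using Fin.cases <;> rfl

theorem sum_gluedEdge (f : GluedEdge (fun j => N j + 1) → ℂ) :
    ∑ e, f e = (∑ s : (j : Fin r) × Fin (N j), f ⟨s.1, s.2.succ⟩) + ∑ j, f ⟨j, 0⟩ := by
  simp only [Fintype.sum_sigma, ← Finset.sum_add_distrib, Fin.sum_univ_succ, add_comm]

theorem gluedVertex_add_one (j : Fin r) (l : Fin (N j)) :
    gluedVertex (fun j => N j + 1) j (l + 1) = some ⟨j, l⟩ :=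
  dif_pos ⟨by omega, show (l : ℕ) + 1 < N j + 1 by omega⟩

/-- For the last edge of a cycle the far end is the common vertex, so neither side can hold; this is
why the incidence block below is triangular and not cyclic. -/
theorem gluedVertex_add_two_eq_some (j : Fin r) (l : Fin (N j)) (s : (j : Fin r) × Fin (N j)) :
    gluedVertex (fun j => N j + 1) j (l + 1 + 1) = some s ↔ j = s.1 ∧ (l : ℕ) + 1 = s.2 := by
  obtain ⟨j', l'⟩ := s
  by_cases h : (l : ℕ) + 1 < N j
  · rw [gluedVertex_add_one j ⟨l + 1, h⟩, Option.some_inj]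
    constructor
    · intro h'
      cases h'
      exact ⟨rfl, rfl⟩
    · rintro ⟨rfl, h'⟩
      congr
  · rw [gluedVertex, dif_neg (by omega)]
    simp only [reduceCtorEq, false_iff]
    rintro ⟨rfl, h'⟩
    exact h (h' ▸ l'.2)

/-- The square block of the incidence matrix at the interior vertices is unipotent. -/
theorem det_unsignedIncidence_interior (fwd : GluedEdge (fun j => N j + 1) → Bool) :
    (of fun s t : (j : Fin r) × Fin (N j) =>
      unsignedIncidence (gluedCycles _ fwd) (some s) ⟨t.1, t.2.succ⟩).det = 1 := by
  set T : Matrix ((j : Fin r) × Fin (N j)) ((j : Fin r) × Fin (N j)) ℂ := of fun s t =>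
      unsignedIncidence (gluedCycles (fun j => N j + 1) fwd) (some s) ⟨t.1, t.2.succ⟩ with hT
  have happ : ∀ s t, T s t = (if t = s then 1 else 0)
      + (if t.1 = s.1 ∧ (t.2 : ℕ) + 1 = s.2 then 1 else 0) := by
    intro s t
    rw [hT, of_apply, unsignedIncidence_gluedCycles]
    simp only [Fin.val_succ, gluedVertex_add_one, Option.some_inj, gluedVertex_add_two_eq_some]
    rfl
  have htri : BlockTriangular Tᵀ fun s => (s.2 : ℕ) := by
    intro s t hst
    rw [transpose_apply, happ, if_neg, if_neg, add_zero]
    · rintro ⟨-, h⟩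
      simp only at hst
      omega
    · rintro rfl
      exact lt_irrefl _ hst
  rw [← det_transpose, htri.det]
  refine Finset.prod_eq_one fun a _ => ?_
  -- The blocks group the vertices at equal position in different cycles; such vertices share no
  -- edge of the block.
  suffices h : toSquareBlock Tᵀ (fun s => (s.2 : ℕ)) a = 1 by rw [h, det_one]
  ext ⟨s, hs⟩ ⟨t, ht⟩
  rw [toSquareBlock_def, of_apply, transpose_apply, happ, if_neg (c := _ ∧ _), add_zero, one_apply]
  · simp
  · rintro ⟨-, h⟩
    have hs' : (s.2 : ℕ) = a := hs
    have ht' : (t.2 : ℕ) = a := ht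
    simp only at h
    omega

/-- The determinant governing the leading behaviour of the secular matrix. -/
theorem det_unsignedIncidence_saddle {n : Fin r → ℕ} (hn : ∀ j, Odd (n j))
    (fwd : GluedEdge n → Bool) (d : GluedEdge n → ℂ) :
    (fromBlocks 0 (-unsignedIncidence (gluedCycles n fwd))
      (-(unsignedIncidence (gluedCycles n fwd))ᵀ) (diagonal d)).det
      = -4 * ∑ i, ∏ j ∈ Finset.univ.erase i, ∑ l : Fin (n j), d ⟨j, l⟩ := by
  obtain ⟨N, rfl⟩ : ∃ N : Fin r → ℕ, n = fun j => N j + 1 :=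
    ⟨fun j => n j - 1, funext fun j => (Nat.sub_add_cancel (hn j).pos).symm⟩
  set I := unsignedIncidence (gluedCycles (fun j => N j + 1) fwd) with hI
  set A := alternatingColumns fun j => N j + 1 with hA
  let T : Matrix ((j : Fin r) × Fin (N j)) ((j : Fin r) × Fin (N j)) ℂ :=
    of fun s t => I (some s) ⟨t.1, t.2.succ⟩
  let τ : Matrix ((j : Fin r) × Fin (N j)) (Fin r) ℂ := of fun s j => I (some s) ⟨j, 0⟩
  let σ : Matrix Unit ((j : Fin r) × Fin (N j)) ℂ := of fun _ t => I none ⟨t.1, t.2.succ⟩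
  let ρ : Matrix Unit (Fin r) ℂ := of fun _ j => I none ⟨j, 0⟩
  let D : Matrix ((j : Fin r) × Fin (N j)) ((j : Fin r) × Fin (N j)) ℂ :=
    diagonal fun s => d ⟨s.1, s.2.succ⟩
  let Δ : Matrix (Fin r) (Fin r) ℂ := diagonal fun j => d ⟨j, 0⟩
  let α : Matrix ((j : Fin r) × Fin (N j)) (Fin r) ℂ := of fun s j => A ⟨s.1, s.2.succ⟩ j
  have hA0 : ∀ i j, A ⟨i, 0⟩ j = (1 : Matrix (Fin r) (Fin r) ℂ) i j := fun i j => by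
    simp [hA, alternatingColumns, one_apply]
  have hne : ∀ (s : (j : Fin r) × Fin (N j)) (j : Fin r),
      (⟨s.1, s.2.succ⟩ : GluedEdge fun j => N j + 1) ≠ ⟨j, 0⟩ := fun s j h => by
    simpa using congrArg (fun e : GluedEdge fun j => N j + 1 => (e.2 : ℕ)) h
  have hinj : ∀ s t : (j : Fin r) × Fin (N j),
      (⟨s.1, s.2.succ⟩ : GluedEdge fun j => N j + 1) = ⟨t.1, t.2.succ⟩ ↔ s = t := by
    rintro ⟨j, l⟩ ⟨j', l'⟩
    refine ⟨fun h => ?_, fun h => by rw [h]⟩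
    obtain rfl : j = j' := congrArg Sigma.fst h
    simpa using h
  -- Rows and columns are permuted alike, so the determinant is unchanged; the result has the saddle
  -- form with -T as pivot.
  have hsub : (fromBlocks 0 (-I) (-Iᵀ) (diagonal d)).submatrix (gluedIndex N) (gluedIndex N)
      = fromBlocks (fromBlocks 0 (-T) (-T)ᵀ D) (fromBlocks 0 (-τ) (-σ)ᵀ 0)
        (fromBlocks 0 (-σ) (-τ)ᵀ 0) (fromBlocks 0 (-ρ) (-ρ)ᵀ Δ) := by
    ext ((s | s) | (u | j)) ((t | t) | (u' | j')) <;> try rfl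
    · simp only [submatrix_apply, gluedIndex, Equiv.coe_fn_mk, fromBlocks_apply₂₂,
        fromBlocks_apply₁₁, D, diagonal_apply, hinj]
    · exact diagonal_apply_ne _ (hne s j')
    · exact diagonal_apply_ne _ (hne t j).symm
    · by_cases h : j = j'
      · subst h
        simp [gluedIndex, Δ]
      · exact (diagonal_apply_ne _ fun h' => h (congrArg Sigma.fst h')).trans
          (show (0 : ℂ) = Δ j j' from (diagonal_apply_ne _ h).symm)
  have hIA : I * A = of fun v _ => if v = none then 2 else 0 :=
    unsignedIncidence_mul_alternatingColumns hn fwd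
  have hIA' : ∀ v j, (∑ s : (j : Fin r) × Fin (N j), I v ⟨s.1, s.2.succ⟩ * α s j) + I v ⟨j, 0⟩
      = if v = none then 2 else 0 := fun v j => by
    have := congrFun (congrFun hIA v) j
    rw [mul_apply, sum_gluedEdge] at this
    simp only [hA0, one_apply] at this
    simpa [-Finset.univ_sigma_univ, α, I, A] using this
  have hα : -T * α + -τ = 0 := by
    ext s j
    have := hIA' (some s) j
    simp only [reduceCtorEq, if_false] at this
    rw [Matrix.neg_mul, ← neg_add, Matrix.neg_apply, Matrix.add_apply, mul_apply, Matrix.zero_apply,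
      neg_eq_zero]
    exact this
  have hρ : -σ * α + -ρ = of fun _ _ => -2 := by
    ext u j
    have := hIA' none j
    rw [if_pos rfl] at this
    rw [Matrix.neg_mul, ← neg_add, Matrix.neg_apply, Matrix.add_apply, mul_apply, of_apply, neg_inj]
    exact this
  have hD : αᵀ * D * α + Δ = diagonal fun j => ∑ l : Fin (N j + 1), d ⟨j, l⟩ := by
    have hAD := alternatingColumns_conj_diagonal (fun j => N j + 1) d
    ext i j
    rw [← hAD, Matrix.add_apply, mul_apply, mul_apply, sum_gluedEdge]
    congr 1
    · refine Finset.sum_congr rfl fun s _ => ?_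
      rw [mul_diagonal, mul_diagonal]
      rfl
    · rw [Finset.sum_eq_single j]
      · rw [mul_diagonal, transpose_apply, ← hA, hA0, hA0, one_apply_eq, mul_one]
        by_cases h : i = j
        · subst h
          simp [Δ]
        · simp [Δ, h, Ne.symm h]
      · intro k _ hk
        rw [← hA, hA0, one_apply_ne hk, mul_zero]
      · simp
  have hT : T.det = 1 := det_unsignedIncidence_interior fwd
  -- An odd cycle has an even number n_j - 1 of interior vertices, so no sign survives the
  -- elimination.
  have hcard : (-1 : ℂ) ^ Fintype.card ((j : Fin r) × Fin (N j)) = 1 := by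
    refine Even.neg_one_pow ?_
    rw [Fintype.card_sigma]
    refine Finset.even_sum _ fun j _ => ?_
    have := hn j
    rw [Fintype.card_fin]
    grind
  have hTn : (-T).det = 1 := by rw [det_neg, hT, hcard, one_mul]
  rw [← det_submatrix_equiv_self (gluedIndex N), hsub,
    det_saddle_eliminate _ _ _ _ _ _ _ (by rw [hTn]; exact isUnit_one) hα, hTn, hcard, hρ, hD]
  -- The border -2 comes from `hρ`, and -(-2)² is the factor -4.
  have := det_bordered_diagonal (-2) fun j => ∑ l : Fin (N j + 1), d ⟨j, l⟩
  rw [one_pow, one_mul, one_mul]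
  refine Eq.trans ?_ (this.trans ?_)
  · rfl
  · norm_num

end Glued

/-! ### Perturbation of determinants -/

section Perturbation

variable {ι κ : Type*} {F : Filter ι}

/-- Difference of two products with factors of prescribed orders. -/
theorem isLittleO_prod_sub_prod (s : Finset κ) {f h : κ → ι → ℂ} {g : κ → ι → ℝ} {δ : ι → ℝ}
    (hδ : δ =O[F] fun _ => (1 : ℝ)) (hf : ∀ i ∈ s, f i =O[F] g i)
    (hfh : ∀ i ∈ s, (fun x => f i x - h i x) =o[F] fun x => g i x * δ x) :
    (fun x => ∏ i ∈ s, f i x - ∏ i ∈ s, h i x) =o[F] fun x => (∏ i ∈ s, g i x) * δ x := by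
  classical
  induction s using Finset.induction_on with
  | empty => simp
  | insert a s ha ih =>
    have hfs := fun i hi => hf i (Finset.mem_insert_of_mem hi)
    have ih := ih hfs fun i hi => hfh i (Finset.mem_insert_of_mem hi)
    have hfa := hf a (Finset.mem_insert_self _ _)
    have hfha := hfh a (Finset.mem_insert_self _ _)
    have hha : h a =O[F] g a := by
      have h1 : (fun x => g a x * δ x) =O[F] g a := by
        simpa using (isBigO_refl (g a) F).mul hδ
      simpa using hfa.sub (hfha.isBigO.trans h1)
    have hprod : (fun x => ∏ i ∈ s, f i x) =O[F] fun x => ∏ i ∈ s, g i x :=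
      IsBigO.finsetProd hfs
    -- Telescoping: f_a∏f - h_a∏h = (f_a - h_a)∏f + h_a(∏f - ∏h).
    have e1 := hfha.mul_isBigO hprod
    have e2 := hha.mul_isLittleO ih
    refine ((e1.trans_isBigO (isBigO_of_le _ fun x => le_of_eq ?_)).add
      (e2.trans_isBigO (isBigO_of_le _ fun x => le_of_eq ?_))).congr (fun x => ?_) fun x => rfl
    · rw [Finset.prod_insert ha]; ring_nf
    · rw [Finset.prod_insert ha]; ring_nf
    · rw [Finset.prod_insert ha, Finset.prod_insert ha]; ring

/-- Perturbation of a determinant whose entries have orders given by row and column weights. -/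
theorem isLittleO_det_sub_det [Fintype κ] [DecidableEq κ] {X Y : ι → Matrix κ κ ℂ}
    {r c : κ → ι → ℝ} {δ : ι → ℝ} (hδ : δ =O[F] fun _ => (1 : ℝ))
    (hX : ∀ i j, (fun x => X x i j) =O[F] fun x => r i x * c j x)
    (hXY : ∀ i j, (fun x => X x i j - Y x i j) =o[F] fun x => r i x * c j x * δ x) :
    (fun x => (X x).det - (Y x).det) =o[F]
      fun x => (∏ i, r i x) * (∏ j, c j x) * δ x := by
  simp only [det_apply, ← Finset.sum_sub_distrib, ← smul_sub]
  refine IsLittleO.fun_sum fun σ _ => ?_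
  have h := isLittleO_prod_sub_prod Finset.univ hδ (f := fun i x => X x (σ i) i)
    (h := fun i x => Y x (σ i) i) (fun i _ => hX (σ i) i) fun i _ => hXY (σ i) i
  -- Every term of the Leibniz formula has the same total weight, because a permutation uses each
  -- row and column once.
  have hperm : ∀ x, ∏ i, r (σ i) x = ∏ i, r i x := fun x => Equiv.prod_comp σ fun i => r i x
  simp only [Finset.prod_mul_distrib, hperm] at h
  rcases Int.units_eq_one_or (Equiv.Perm.sign σ) with hσ | hσ
  · simpa only [hσ, one_smul] using h
  · simp only [hσ, Units.neg_smul, one_smul]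
    exact h.neg_left

end Perturbation

/-! ### From powers of ω to powers of √λ -/

theorem norm_sqrtParam_sq (lam : ℂ) : ‖sqrtParam lam‖ ^ 2 = ‖lam‖ := by
  rw [← norm_pow, sqrtParam, one_div]
  congr 1
  exact_mod_cast Complex.cpow_nat_inv_pow lam two_ne_zero

theorem sqrtParam_sq (lam : ℂ) : sqrtParam lam ^ 2 = lam := by
  rw [sqrtParam, one_div]
  exact_mod_cast Complex.cpow_nat_inv_pow lam two_ne_zero

theorem norm_rpow_neg_div_two (lam : ℂ) (a : ℕ) :
    ‖lam‖ ^ (-(a : ℝ) / 2) = (‖sqrtParam lam‖⁻¹) ^ a := by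
  rw [← norm_sqrtParam_sq, ← Real.rpow_natCast, ← Real.rpow_mul (norm_nonneg _),
    inv_pow, ← Real.rpow_natCast, ← Real.rpow_neg (norm_nonneg _)]
  congr 1
  push_cast
  ring

section Glued

variable {ι : Type*} {F : Filter ι} {ω : ι → ℝ} {lam : ι → ℂ}

theorem isTheta_sqrtParam (hω : Tendsto ω F atTop)
    (hlam : (fun x => lam x - (ω x : ℂ) ^ 2) =O[F] fun _ => (1 : ℝ)) :
    (fun x => ‖sqrtParam (lam x)‖) =Θ[F] ω := by
  have hω2 : Tendsto (fun x => ω x ^ 2) F atTop := (tendsto_pow_atTop two_ne_zero).comp hω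
  have h1 : (fun x => lam x - (ω x : ℂ) ^ 2) =o[F] fun x => (ω x : ℂ) ^ 2 := by
    refine hlam.trans_isLittleO ?_
    rw [isLittleO_const_left]
    right
    simpa [Function.comp_def] using hω2
  have heq : lam ~[F] fun x => (ω x : ℂ) ^ 2 := h1
  have hsq : (fun x => ‖sqrtParam (lam x)‖ ^ 2) =Θ[F] fun x => ω x ^ 2 := by
    simp only [norm_sqrtParam_sq]
    have := heq.isTheta.norm_left.norm_right
    simpa using this
  exact ⟨IsBigO.of_pow two_ne_zero hsq.1, IsBigO.of_pow two_ne_zero hsq.2⟩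

/-- The first Betti number of the graph is r; this fixes the exponent of the error term. -/
theorem card_gluedEdge {r : ℕ} {n : Fin r → ℕ} (hn : ∀ j, Odd (n j)) :
    Fintype.card (GluedEdge n) + 1 = Fintype.card (GluedVertex n) + r := by
  rw [Fintype.card_option, Fintype.card_sigma, Fintype.card_sigma]
  simp only [Fintype.card_fin]
  have : ∑ j, n j = ∑ j, ((n j - 1) + 1) :=
    Finset.sum_congr rfl fun j _ => (Nat.sub_add_cancel (hn j).pos).symm
  rw [this, Finset.sum_add_distrib]
  simp
  omega

end Glued
section Asymptotics

variable {ι : Type*} {F : Filter ι} {ω : ι → ℝ} {lam : ι → ℂ}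

theorem eventually_sqrtParam_ne_zero (hω : Tendsto ω F atTop)
    (hlam : (fun x => lam x - (ω x : ℂ) ^ 2) =O[F] fun _ => (1 : ℝ)) :
    ∀ᶠ x in F, sqrtParam (lam x) ≠ 0 := by
  obtain ⟨C, hC⟩ := (isTheta_sqrtParam hω hlam).2.bound
  filter_upwards [hC, hω.eventually_gt_atTop 0] with x hx hpos h
  rw [h] at hx
  simp only [norm_zero, mul_zero, norm_le_zero_iff] at hx
  exact hpos.ne' hx

theorem isBigO_inv_pow_sqrtParam (hω : Tendsto ω F atTop)
    (hlam : (fun x => lam x - (ω x : ℂ) ^ 2) =O[F] fun _ => (1 : ℝ)) (k : ℕ) :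
    (fun x => ((ω x : ℂ)⁻¹) ^ k) =O[F] fun x => ‖sqrtParam (lam x)‖⁻¹ ^ k := by
  have h1 : (fun x => (ω x : ℂ)⁻¹) =O[F] fun x => ‖sqrtParam (lam x)‖⁻¹ := by
    have h2 : (fun x => (ω x : ℂ)⁻¹) =O[F] fun x => (ω x)⁻¹ := isBigO_of_le _ fun x => by simp
    exact h2.trans (isTheta_sqrtParam hω hlam).inv.2
  exact h1.pow k

theorem isLittleO_inv_pow_of_mul (hω : Tendsto ω F atTop)
    (hlam : (fun x => lam x - (ω x : ℂ) ^ 2) =O[F] fun _ => (1 : ℝ)) {k : ℕ} {f : ι → ℂ}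
    (hf : (fun x => (ω x : ℂ) ^ k * f x) =o[F] fun _ => (1 : ℝ)) :
    f =o[F] fun x => ‖sqrtParam (lam x)‖⁻¹ ^ k := by
  have h := (isBigO_inv_pow_sqrtParam hω hlam k).mul_isLittleO hf
  simp only [mul_one] at h
  refine h.congr' ?_ EventuallyEq.rfl
  filter_upwards [hω.eventually_gt_atTop 0] with x hx
  have hx' : (ω x : ℂ) ≠ 0 := by exact_mod_cast hx.ne'
  rw [← mul_assoc, ← mul_pow, inv_mul_cancel₀ hx', one_pow, one_mul]

theorem isBigO_inv_pow_of_mul (hω : Tendsto ω F atTop)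
    (hlam : (fun x => lam x - (ω x : ℂ) ^ 2) =O[F] fun _ => (1 : ℝ)) {k : ℕ} {f : ι → ℂ}
    (hf : (fun x => (ω x : ℂ) ^ k * f x) =O[F] fun _ => (1 : ℝ)) :
    f =O[F] fun x => ‖sqrtParam (lam x)‖⁻¹ ^ k := by
  have h := (isBigO_inv_pow_sqrtParam hω hlam k).mul hf
  simp only [mul_one] at h
  refine h.congr' ?_ EventuallyEq.rfl
  filter_upwards [hω.eventually_gt_atTop 0] with x hx
  have hx' : (ω x : ℂ) ≠ 0 := by exact_mod_cast hx.ne'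
  rw [← mul_assoc, ← mul_pow, inv_mul_cancel₀ hx', one_pow, one_mul]

theorem isBigO_inv_norm_sqrtParam (hω : Tendsto ω F atTop)
    (hlam : (fun x => lam x - (ω x : ℂ) ^ 2) =O[F] fun _ => (1 : ℝ)) :
    (fun x => ‖sqrtParam (lam x)‖⁻¹) =O[F] fun _ => (1 : ℝ) :=
  (isTheta_sqrtParam hω hlam).inv.1.trans
    ((isLittleO_one_iff ℝ).2 hω.inv_tendsto_atTop).isBigO

variable {q : ℝ → ℂ}

theorem isBigO_sinSol (hq : IntervalIntegrable q volume 0 1) (hω : Tendsto ω F atTop)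
    (hexp : ∀ x, Complex.exp (ω x * Complex.I) = -1)
    (hlam : (fun x => lam x - (ω x : ℂ) ^ 2) =O[F] fun _ => (1 : ℝ)) :
    (fun x => sinSol q (lam x) 1) =O[F] fun x => ‖sqrtParam (lam x)‖⁻¹ ^ 2 := by
  refine isBigO_inv_pow_of_mul hω hlam ?_
  have h := (sinSol_asymptotics hq hω hexp hlam).2.isBigO
  have h2 : (fun x => ((∫ t in (0 : ℝ)..1, q t) - (lam x - (ω x : ℂ) ^ 2)) / 2)
      =O[F] fun _ => (1 : ℝ) := by
    simpa [div_eq_inv_mul] using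
      ((isBigO_const_const _ one_ne_zero _).sub hlam).const_mul_left (2⁻¹ : ℂ)
  simpa using h.add h2

theorem isBigO_sqrtParam_mul_sinSol (hq : IntervalIntegrable q volume 0 1)
    (hω : Tendsto ω F atTop) (hexp : ∀ x, Complex.exp (ω x * Complex.I) = -1)
    (hlam : (fun x => lam x - (ω x : ℂ) ^ 2) =O[F] fun _ => (1 : ℝ)) :
    (fun x => sqrtParam (lam x) * sinSol q (lam x) 1) =O[F]
      fun x => ‖sqrtParam (lam x)‖⁻¹ := by
  have h := ((isBigO_refl (fun x => sqrtParam (lam x)) F).norm_right).mul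
    (isBigO_sinSol hq hω hexp hlam)
  refine h.congr' EventuallyEq.rfl ?_
  filter_upwards [eventually_sqrtParam_ne_zero hω hlam] with x hx
  have := norm_ne_zero_iff.2 hx
  field_simp

theorem sqrtParam_mul_sinSol_asymptotics (hq : IntervalIntegrable q volume 0 1)
    (hω : Tendsto ω F atTop) (hexp : ∀ x, Complex.exp (ω x * Complex.I) = -1) {d : ℂ}
    (hd : (fun x => lam x - ((ω x : ℂ) ^ 2 + d)) =o[F] fun _ => (1 : ℝ)) :
    (fun x => sqrtParam (lam x) * sinSol q (lam x) 1
      - -1 / (2 * sqrtParam (lam x)) * (d - ∫ t in (0 : ℝ)..1, q t)) =o[F]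
      fun x => ‖sqrtParam (lam x)‖⁻¹ := by
  have hlam : (fun x => lam x - (ω x : ℂ) ^ 2) =O[F] fun _ => (1 : ℝ) := by
    have := hd.isBigO.add (isBigO_const_const d (one_ne_zero : (1 : ℝ) ≠ 0) F)
    simpa [← sub_sub] using this
  have h1 := (sinSol_asymptotics hq hω hexp hlam).2
  have hs : (fun x => sinSol q (lam x) 1) =o[F] fun _ => (1 : ℝ) := by
    have h0 : (fun x => ‖sqrtParam (lam x)‖⁻¹ ^ 2) =o[F] fun _ => (1 : ℝ) := by
      have := (isTheta_sqrtParam hω hlam).inv.1.trans_isLittleO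
        ((isLittleO_one_iff ℝ).2 hω.inv_tendsto_atTop)
      simpa using this.pow two_pos
    exact (isBigO_sinSol hq hω hexp hlam).trans_isLittleO h0
  have h2 : (fun x => (lam x - (ω x : ℂ) ^ 2) * sinSol q (lam x) 1) =o[F] fun _ => (1 : ℝ) := by
    simpa using hlam.mul_isLittleO hs
  -- The combination equals λs(1) + (d - ∫q)/2; dividing by √λ gives the claim.
  have h3 := (h1.add h2).sub (hd.const_mul_left (1 / 2))
  have hinv : (fun x => (sqrtParam (lam x))⁻¹) =O[F] fun x => ‖sqrtParam (lam x)‖⁻¹ :=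
    isBigO_of_le _ fun x => by simp
  have h4 := hinv.mul_isLittleO h3
  simp only [mul_one] at h4
  refine h4.congr' ?_ EventuallyEq.rfl
  filter_upwards [eventually_sqrtParam_ne_zero hω hlam] with x hx
  field_simp
  rw [sqrtParam_sq]
  ring

end Asymptotics

/-! ### Asymptotics of the secular determinant -/

section Glued

variable {ι : Type*} {F : Filter ι} {ω : ι → ℝ} {lam : ι → ℂ} {r : ℕ} {n : Fin r → ℕ}
  {q : GluedEdge n → ℝ → ℂ}

/-- The matrix is compared with the saddle matrix `Y`, which keeps D exactly. Row and column weights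
are needed because the blocks have different orders: the A position has weight |√λ|, so an error
o(1) is allowed there and A = O(|√λ|⁻¹) is negligible. -/
theorem det_secularMatrix_isLittleO (hn : ∀ j, Odd (n j)) (fwd : GluedEdge n → Bool)
    (hq : ∀ e, IntervalIntegrable (q e) volume 0 1) (hω : Tendsto ω F atTop)
    (hexp : ∀ x, Complex.exp (ω x * Complex.I) = -1)
    (hlam : (fun x => lam x - (ω x : ℂ) ^ 2) =O[F] fun _ => (1 : ℝ)) :
    (fun x => (secularMatrix (gluedCycles n fwd) q (lam x)).det
      - (-4) * ∑ i : Fin r, ∏ j ∈ Finset.univ.erase i, ∑ l : Fin (n j),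
        sqrtParam (lam x) * sinSol (q ⟨j, l⟩) (lam x) 1)
      =o[F] fun x => ‖sqrtParam (lam x)‖⁻¹ ^ r := by
  set G := gluedCycles n fwd with hG
  set g : ι → ℝ := fun x => ‖sqrtParam (lam x)‖ with hg
  have hne : ∀ᶠ x in F, g x ≠ 0 := by
    filter_upwards [eventually_sqrtParam_ne_zero hω hlam] with x hx
    exact norm_ne_zero_iff.2 hx
  have hδ : (fun x => (g x)⁻¹) =O[F] fun _ => (1 : ℝ) := isBigO_inv_norm_sqrtParam hω hlam
  have hgO : (fun _ => (1 : ℝ)) =O[F] g := by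
    have h1 := (isTheta_sqrtParam hω hlam).2
    refine IsBigO.trans ?_ h1
    refine (isLittleO_const_left.2 (Or.inr ?_)).isBigO
    exact tendsto_norm_atTop_atTop.comp hω
  have hc := fun e => cosSol_asymptotics (hq e) hω hexp hlam
  have hs := fun e => sinSol_asymptotics (hq e) hω hexp hlam
  have hc1 : ∀ e, (fun x => cosSol (q e) (lam x) 1 + 1) =o[F] fun x => (g x)⁻¹ := fun e => by
    simpa using isLittleO_inv_pow_of_mul hω hlam (k := 1) (by simpa using (hc e).1)
  have hs1 : ∀ e, (fun x => sinSolDerivOne (q e) (lam x) + 1) =o[F] fun x => (g x)⁻¹ :=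
    fun e => by
      simpa using isLittleO_inv_pow_of_mul hω hlam (k := 1) (by simpa using (hs e).1)
  let Y : ι → Matrix (GluedVertex n ⊕ GluedEdge n) (GluedVertex n ⊕ GluedEdge n) ℂ := fun x =>
    fromBlocks 0 (-unsignedIncidence G) (-(unsignedIncidence G)ᵀ) (blockD q (lam x))
  let rowW : GluedVertex n ⊕ GluedEdge n → ι → ℝ := Sum.elim (fun _ _ => 1) fun _ x => (g x)⁻¹
  let colW : GluedVertex n ⊕ GluedEdge n → ι → ℝ := Sum.elim (fun _ => g) fun _ _ => 1
  have hone : ∀ {f : ι → ℂ}, f =o[F] (fun x => (g x)⁻¹) →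
      f =o[F] fun x => (g x)⁻¹ * g x * (g x)⁻¹ := fun hf => hf.congr' EventuallyEq.rfl (by
    filter_upwards [hne] with x hx
    rw [inv_mul_cancel₀ hx, one_mul])
  have hA : ∀ v u, (fun x => blockA G q (lam x) v u) =O[F] fun x => (g x)⁻¹ := fun v u => by
    have h1 : (fun x => 1 / sqrtParam (lam x)) =O[F] fun x => (g x)⁻¹ :=
      isBigO_of_le _ fun x => by simp [hg]
    have h2 : (fun x => ∑ e ∈ Finset.univ.filter (fun e => G.src e = u ∧ G.tgt e = v),
        cosSolDerivOne (q e) (lam x)) =O[F] fun _ => (1 : ℝ) :=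
      IsBigO.fun_sum fun e _ => (hc e).2
    simpa [blockA] using h1.mul h2
  have hdiff : ∀ i j, (fun x => secularMatrix G q (lam x) i j - Y x i j)
      =o[F] fun x => rowW i x * colW j x * (g x)⁻¹ := by
    rintro (v | e) (u | f)
    · simp only [secularMatrix, Y, fromBlocks_apply₁₁, Matrix.zero_apply, sub_zero, rowW, colW,
        Sum.elim_inl, one_mul]
      have h1 : (fun x => (g x)⁻¹) =o[F] fun _ => (1 : ℝ) :=
        (isTheta_sqrtParam hω hlam).inv.1.trans_isLittleO
          ((isLittleO_one_iff ℝ).2 hω.inv_tendsto_atTop)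
      refine ((hA v u).trans_isLittleO h1).congr' EventuallyEq.rfl ?_
      filter_upwards [hne] with x hx
      rw [mul_inv_cancel₀ hx]
    · simp only [secularMatrix, Y, fromBlocks_apply₁₂, rowW, colW, Sum.elim_inl, Sum.elim_inr,
        one_mul]
      by_cases h : G.tgt f = v
      · refine (hs1 f).congr_left fun x => ?_
        simp only [blockB, unsignedIncidence, Matrix.neg_apply, of_apply, if_pos h]
        ring
      · refine (isLittleO_zero _ F).congr_left fun x => ?_
        simp [blockB, unsignedIncidence, h]
    · simp only [secularMatrix, Y, fromBlocks_apply₂₁, rowW, colW, Sum.elim_inl, Sum.elim_inr]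
      refine hone ?_
      by_cases h : G.src e = u
      · refine (hc1 e).congr_left fun x => ?_
        simp only [blockC, unsignedIncidence, Matrix.neg_apply, transpose_apply, of_apply,
          if_pos h]
        ring
      · refine (isLittleO_zero _ F).congr_left fun x => ?_
        simp [blockC, unsignedIncidence, h]
    · simp only [secularMatrix, Y, fromBlocks_apply₂₂, sub_self]
      exact isLittleO_zero _ _
  have hY : ∀ i j, (fun x => Y x i j) =O[F] fun x => rowW i x * colW j x := by
    rintro (v | e) (u | f)
    · simp only [Y, fromBlocks_apply₁₁, Matrix.zero_apply]
      exact isBigO_zero _ _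
    · simp only [Y, fromBlocks_apply₁₂, rowW, colW, Sum.elim_inl, Sum.elim_inr, one_mul]
      exact isBigO_const_const _ one_ne_zero _
    · simp only [Y, fromBlocks_apply₂₁, rowW, colW, Sum.elim_inl, Sum.elim_inr]
      refine (isBigO_const_const _ (one_ne_zero : (1 : ℝ) ≠ 0) F).congr' EventuallyEq.rfl ?_
      filter_upwards [hne] with x hx
      rw [inv_mul_cancel₀ hx]
    · simp only [Y, fromBlocks_apply₂₂, rowW, colW, Sum.elim_inr, mul_one, blockD]
      by_cases h : e = f
      · subst h
        simp only [diagonal_apply_eq]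
        exact isBigO_sqrtParam_mul_sinSol (hq e) hω hexp hlam
      · simp only [diagonal_apply_ne _ h]
        exact isBigO_zero _ _
  have hX : ∀ i j, (fun x => secularMatrix G q (lam x) i j)
      =O[F] fun x => rowW i x * colW j x := fun i j => by
    have h1 : (fun x => rowW i x * colW j x * (g x)⁻¹) =O[F] fun x => rowW i x * colW j x := by
      simpa using (isBigO_refl (fun x => rowW i x * colW j x) F).mul hδ
    simpa using ((hdiff i j).isBigO.trans h1).add (hY i j)
  have hmain := isLittleO_det_sub_det hδ hX hdiff
  refine hmain.congr' ?_ ?_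
  · refine Eventually.of_forall fun x => ?_
    simp only [Y, blockD]
    rw [det_unsignedIncidence_saddle hn fwd fun e => sqrtParam (lam x) * sinSol (q e) (lam x) 1]
  · filter_upwards [hne] with x hx
    simp only [rowW, colW, Fintype.prod_sum_type, Sum.elim_inl, Sum.elim_inr, Finset.prod_const_one,
      one_mul, mul_one, Finset.prod_const, Finset.card_univ]
    -- The total weight is g^{|V|} g^{-|E|-1}, which equals g^{-r} by the edge count.
    rw [mul_right_comm, ← pow_succ, card_gluedEdge hn, pow_add, mul_right_comm, ← mul_pow,
      inv_mul_cancel₀ hx, one_pow, one_mul]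

/-- Each of the r - 1 factors is -1/(2√λ) times a factor of `eigPol`, up to o(|√λ|⁻¹), because the
term d is added once for each of the n_j edges. -/
theorem sum_prod_sinSol_isLittleO (hq : ∀ e, IntervalIntegrable (q e) volume 0 1)
    (hω : Tendsto ω F atTop) (hexp : ∀ x, Complex.exp (ω x * Complex.I) = -1) {d : ℂ}
    (hd : (fun x => lam x - ((ω x : ℂ) ^ 2 + d)) =o[F] fun _ => (1 : ℝ)) :
    (fun x => (∑ i : Fin r, ∏ j ∈ Finset.univ.erase i, ∑ l : Fin (n j),
        sqrtParam (lam x) * sinSol (q ⟨j, l⟩) (lam x) 1)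
      - (-1 / (2 * sqrtParam (lam x))) ^ (r - 1) * eigPol n q d)
      =o[F] fun x => ‖sqrtParam (lam x)‖⁻¹ ^ (r - 1) := by
  have hlam : (fun x => lam x - (ω x : ℂ) ^ 2) =O[F] fun _ => (1 : ℝ) := by
    have := hd.isBigO.add (isBigO_const_const d (one_ne_zero : (1 : ℝ) ≠ 0) F)
    simpa [← sub_sub] using this
  have hcard : ∀ i : Fin r, (Finset.univ.erase i).card = r - 1 := fun i => by simp
  have hdist : ∀ x, (-1 / (2 * sqrtParam (lam x))) ^ (r - 1) * eigPol n q d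
      = ∑ i : Fin r, ∏ j ∈ Finset.univ.erase i, (-1 / (2 * sqrtParam (lam x))
        * ((n j : ℂ) * d - ∑ l : Fin (n j), ∫ t in (0 : ℝ)..1, q ⟨j, l⟩ t)) := fun x => by
    rw [eigPol, Finset.mul_sum]
    refine Finset.sum_congr rfl fun i _ => ?_
    rw [Finset.prod_mul_distrib, Finset.prod_const, hcard]
  simp only [hdist, ← Finset.sum_sub_distrib]
  refine IsLittleO.fun_sum fun i _ => ?_
  have h := isLittleO_prod_sub_prod (F := F) (Finset.univ.erase i)
    (f := fun j x => ∑ l : Fin (n j), sqrtParam (lam x) * sinSol (q ⟨j, l⟩) (lam x) 1)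
    (h := fun j x => -1 / (2 * sqrtParam (lam x))
        * ((n j : ℂ) * d - ∑ l : Fin (n j), ∫ t in (0 : ℝ)..1, q ⟨j, l⟩ t))
    (g := fun _ x => ‖sqrtParam (lam x)‖⁻¹) (δ := fun _ => 1) (isBigO_refl _ _)
    (fun j _ => IsBigO.fun_sum fun l _ => isBigO_sqrtParam_mul_sinSol (hq _) hω hexp hlam)
    (fun j _ => by
      have h1 : (fun x => ∑ l : Fin (n j), (sqrtParam (lam x) * sinSol (q ⟨j, l⟩) (lam x) 1
          - -1 / (2 * sqrtParam (lam x)) * (d - ∫ t in (0 : ℝ)..1, q ⟨j, l⟩ t)))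
          =o[F] fun x => ‖sqrtParam (lam x)‖⁻¹ :=
        IsLittleO.fun_sum fun l _ => sqrtParam_mul_sinSol_asymptotics (hq _) hω hexp hd
      simp only [mul_one]
      refine h1.congr_left fun x => ?_
      simp [Finset.sum_sub_distrib, ← Finset.mul_sum])
  simpa only [Finset.prod_const, hcard, mul_one] using h

end Glued

end QuantumGraph

theorem mainTheorem4 {r : ℕ} (hr : 2 ≤ r) (n : Fin r → ℕ) (hn : ∀ j, Odd (n j))
    (fwd : QuantumGraph.GluedEdge n → Bool)
    (q : QuantumGraph.GluedEdge n → ℝ → ℂ)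
    (hq : ∀ e, IntervalIntegrable (q e) volume 0 1)
    {ι : Type*} (F : Filter ι) (k : ι → ℕ) (hk : Tendsto k F atTop) (lam : ι → ℂ) :
    ((fun x => lam x - (2 * (k x : ℂ) + 1) ^ 2 * (Real.pi : ℂ) ^ 2) =O[F] (fun _ => (1 : ℝ)) →
      (fun x =>
        (QuantumGraph.secularMatrix (QuantumGraph.gluedCycles n fwd) q (lam x)).det
          - (-4) * ∑ i : Fin r, ∏ j ∈ Finset.univ.erase i, ∑ l : Fin (n j),
              QuantumGraph.sqrtParam (lam x) * QuantumGraph.sinSol (q ⟨j, l⟩) (lam x) 1)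
        =o[F] (fun x => ‖lam x‖ ^ (-(r : ℝ) / 2))) ∧
    (∀ d : ℂ,
      (fun x => lam x - ((2 * (k x : ℂ) + 1) ^ 2 * (Real.pi : ℂ) ^ 2 + d))
        =o[F] (fun _ => (1 : ℝ)) →
      (fun x =>
        (QuantumGraph.secularMatrix (QuantumGraph.gluedCycles n fwd) q (lam x)).det
          - (-4) * (-1 / (2 * QuantumGraph.sqrtParam (lam x))) ^ (r - 1)
              * QuantumGraph.eigPol n q d)
        =o[F] (fun x => ‖lam x‖ ^ (-((r : ℝ) - 1) / 2))) := by
  set ω : ι → ℝ := fun x => (2 * (k x : ℝ) + 1) * Real.pi with hωdef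
  have hω : Tendsto ω F atTop := by
    refine Tendsto.atTop_mul_const Real.pi_pos ?_
    refine tendsto_atTop_add_const_right _ _ ?_
    exact (tendsto_natCast_atTop_atTop.comp hk).const_mul_atTop two_pos
  have hω2 : ∀ x, (2 * (k x : ℂ) + 1) ^ 2 * (Real.pi : ℂ) ^ 2 = (ω x : ℂ) ^ 2 := fun x => by
    rw [hωdef]; push_cast; ring
  have hexp : ∀ x, Complex.exp (ω x * Complex.I) = -1 := fun x => by
    rw [hωdef, show (((2 * (k x : ℝ) + 1) * Real.pi : ℝ) : ℂ) * Complex.I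
      = Real.pi * Complex.I + (k x : ℕ) * (2 * Real.pi * Complex.I) by push_cast; ring,
      Complex.exp_add, Complex.exp_pi_mul_I, Complex.exp_nat_mul_two_pi_mul_I, mul_one]
  simp only [hω2]
  refine ⟨fun hlam => ?_, fun d hd => ?_⟩
  · simp only [QuantumGraph.norm_rpow_neg_div_two]
    exact QuantumGraph.det_secularMatrix_isLittleO hn fwd hq hω hexp hlam
  · have hlam : (fun x => lam x - (ω x : ℂ) ^ 2) =O[F] fun _ => (1 : ℝ) := by
      have := hd.isBigO.add (isBigO_const_const d (one_ne_zero : (1 : ℝ) ≠ 0) F)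
      simpa [← sub_sub] using this
    have hcast : (r : ℝ) - 1 = ((r - 1 : ℕ) : ℝ) := by
      rw [Nat.cast_sub (by omega), Nat.cast_one]
    simp only [hcast, QuantumGraph.norm_rpow_neg_div_two]
    have h1 := QuantumGraph.det_secularMatrix_isLittleO hn fwd hq hω hexp hlam
    -- The error of (i) is smaller than the one allowed in (ii) by a factor |√λ|⁻¹.
    have hpow : (fun x => ‖QuantumGraph.sqrtParam (lam x)‖⁻¹ ^ r) =O[F]
        fun x => ‖QuantumGraph.sqrtParam (lam x)‖⁻¹ ^ (r - 1) := by
      have := (isBigO_refl (fun x => ‖QuantumGraph.sqrtParam (lam x)‖⁻¹ ^ (r - 1)) F).mul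
        (QuantumGraph.isBigO_inv_norm_sqrtParam hω hlam)
      simpa only [← pow_succ, Nat.sub_add_cancel (by omega : 1 ≤ r), mul_one] using this
    have h2 := (QuantumGraph.sum_prod_sinSol_isLittleO (n := n) hq hω hexp hd).const_mul_left (-4)
    refine ((h1.trans_isBigO hpow).add h2).congr_left fun x => ?_
    ring
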